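/- **Setting.** Fix $K\ge 1$, a state vector $\theta=(\theta_1,\dots,\theta_K)'\sim\mathcal N(\mu^0,V^0)$ with $V^0$ positive definite, and $K$ sources; an observation of source $k$ is $X_k=\langle c_k,\theta\rangle+\epsilon_k$, $\epsilon_k\sim\mathcal N(0,\sigma_k^2)$, $\sigma_k^2>0$, with all noise terms independent of each other and of $\theta$. Let $C$ be the matrix with rows $c_k'$. In each period $t=1,2,\dots$ one source is observed. The division vector $d(t)\in\mathbb Z_+^K$ counts the observations of each source up to time $t$, and $f(q)=\big[\big((V^0)^{-1}+C'\,\mathrm{diag}(q_i/\sigma_i^2)\,C\big)^{-1}\big]_{11}$ is the posterior variance of $\theta_1$ after $q_i$ observations of each source $i$. With $\mu_1^t$ the posterior mean of $\theta_1$ after $t$ observations, the belief history at $T$ is $h^T=(\mu_1^0,d(0);\dots;\mu_1^T,d(T))$. An information acquisition strategy $S$ measurably assigns to each belief history $h^t$ the source to be observed in period $t+1$; it may in addition depend on a private randomization device, drawn at the outset independently of $\theta$ and the noise (non-random strategies are included). A decision strategy $A$ measurably assigns to each belief history $h^t$, $t\ge1$ (and the outcome of the device), an action $a_t\in A_t$.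 Payoffs are $U(a_1,a_2,\dots;\theta_1)$ with $U$ measurable; the expected payoff is $E[U^+]-E[U^-]\in[-\infty,\infty]$, set to $-\infty$ if both terms are infinite. A sequence $(d(0),\dots,d(T))$ in $\mathbb Z_+^K$ is *attainable* if $\sum_i d_i(t)=t$ for all $t \le T$ and $d_i(t)\ge d_i(t-1)$ for all $i$ and $1\le t\le T$. A mapping $\tilde G$ from sequences to sequences of the same length is *consistent* if it maps every attainable $(d(0),\dots,d(T))$ to an attainable $(\tilde d(0),\dots,\tilde d(T))$ and $(\tilde d(0),\dots,\tilde d(T-1))=\tilde G(d(0),\dots,d(T-1))$ whenever $T\ge1$. **Lemma.** Let $S$ be an information acquisition strategy and $\tilde G$ a consistent mapping such that $f(\tilde d(T))\le f(d(T))$ for every $T\ge 0$ and every sequence of divisions $(d(0),\dots,d(T))$ realized with positive probability under $S$. Then there is an information acquisition strategy $\tilde S$ such that, for every period $T$, the histories $h^T=(\mu^0_1,d(0);\dots;\mu^T_1,d(T))$ under $S$ can be associated with distributions $\kappa_T(h^T,\cdot)$ of histories $\tilde h^T=(\nu^0_1,\tilde d(0);\dots;\nu^T_1,\tilde d(T))$,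 where $(\tilde d(0),\dots,\tilde d(T))=\tilde G(d(0),\dots,d(T))$, with the following properties: 1. $\kappa_T$ is a Markov kernel, and it transports the law of $h^T$ under $S$ to the law of $\tilde h^T$ under $\tilde S$; 2. conversely, the joint law of $(h^T,\tilde h^T)$ so obtained disintegrates through a Markov kernel from histories $\tilde h^T$ under $\tilde S$ to histories $h^T$ under $S$: each $\tilde h^T$ is associated to histories $h^T$ with total probability $1$; 3. at each period $T$, for almost every $h^T$ under $S$, the distribution of $\nu_1^T$ under $\kappa_T(h^T,\cdot)$ is normal with mean $\mu_1^T$ and variance $f(d(T))-f(\tilde d(T))$; 4. the associations are consistent over time: the joint law of $(h^{T+1},\tilde h^{T+1})$ restricts to that of $(h^T,\tilde h^T)$. Hence for each $t\le T$, conditionally on $h^t$, $\nu_1^t$ is normal with mean $\mu_1^t$ and variance $f(d(t))-f(\tilde d(t))$. Consequently, for all action spaces and every payoff function $U$, and for every decision strategy $A$, there is a decision strategy $\tilde A$ such that the expected payoff under $(\tilde S,\tilde A)$ is no less than that under $(S,A)$. -/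

import Mathlib

open MeasureTheory ProbabilityTheory
open scoped NNReal ENNReal Matrix

namespace DynamicInfo

/-! ### Informational environment, divisions, posterior beliefs -/

/-- `K` states `θ ∼ N(μ⁰, V⁰)` and `K` sources; an observation of source `k` is
`⟨c_k, θ⟩ + ε` with `ε ∼ N(0, σ_k²)`, where `c_k` is row `k` of `C`. -/
structure Environment (K : ℕ) where
  priorMean : EuclideanSpace ℝ (Fin K)
  priorCov : Matrix (Fin K) (Fin K) ℝ
  priorCov_posDef : priorCov.PosDef
  C : Matrix (Fin K) (Fin K) ℝ
  noiseVar : Fin K → ℝ≥0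
  noiseVar_pos : ∀ k, 0 < noiseVar k

/-- A division vector: how often each source has been observed. -/
abbrev Division (K : ℕ) : Type := Fin K → ℕ

/-- A sequence `(d(0), …, d(T))` of vectors of counts. -/
abbrev DivSeq (K T : ℕ) : Type := Fin (T + 1) → Division K

/-- The sequences of divisions that sequential sampling (one observation per period) can attain. -/
def IsDivSeq {K T : ℕ} (δ : DivSeq K T) : Prop :=
  (∀ t, ∑ i, δ t i = (t : ℕ)) ∧ Monotone δ

/-- The consistency requirements on a mapping from sequences of divisions to sequences of
divisions: its values are attainable, and nested sequences are mapped to nested sequences. -/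
structure IsConsistent {K : ℕ} (G : ∀ T : ℕ, DivSeq K T → DivSeq K T) : Prop where
  attainable : ∀ (T : ℕ) (δ : DivSeq K T), IsDivSeq δ → IsDivSeq (G T δ)
  nested : ∀ (T : ℕ) (δ : DivSeq K (T + 1)), IsDivSeq δ →
    (fun t : Fin (T + 1) => G (T + 1) δ t.castSucc) = G T (fun t => δ t.castSucc)

/-- A belief history `(μ_1^0, d(0); …; μ_1^T, d(T))`. -/
abbrev Hist (K T : ℕ) : Type := Fin (T + 1) → ℝ × Division K

/-- The sequence of divisions in a belief history. -/
def divs {K T : ℕ} (h : Hist K T) : DivSeq K T := fun t => (h t).2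

/-- The first `T` periods of a belief history of length `T + 1`. -/
def Hist.init {K T : ℕ} (h : Hist K (T + 1)) : Hist K T := fun t => h t.castSucc

/-- Raw data after `t` periods: the source chosen in each period and the realized observation. -/
abbrev Data (K t : ℕ) : Type := Fin t → Fin K × ℝ

/-- How often each source occurs in the data. -/
def counts {K t : ℕ} (x : Data K t) : Division K :=
  fun k => (Finset.univ.filter fun i => (x i).1 = k).card

namespace Environment

variable {K : ℕ} (E : Environment K)

/-- The posterior covariance matrix of `θ` after `q_i` observations of each source `i`: posterior
precision is prior precision plus `C' D C`, where `D = diag (q_i / σ_i²)`. -/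
noncomputable def postCov (q : Division K) : Matrix (Fin K) (Fin K) ℝ :=
  (E.priorCov⁻¹ + E.Cᵀ * Matrix.diagonal (fun i => (q i : ℝ) / E.noiseVar i) * E.C)⁻¹

/-- The posterior variance of the payoff-relevant state `θ_1` (index `0`).  By the Woodbury
identity this is `[V⁰ - V⁰ C' (C V⁰ C' + D⁻¹)⁻¹ C V⁰]₁₁` when all counts are positive. -/
noncomputable def f [NeZero K] (q : Division K) : ℝ := E.postCov q 0 0

/-- The posterior mean of `θ_1` given the data, by Bayes' rule for Gaussian observations. -/
noncomputable def postMean [NeZero K] {t : ℕ} (x : Data K t) : ℝ :=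
  (E.postCov (counts x) *ᵥ (E.priorCov⁻¹ *ᵥ (fun i => E.priorMean i) +
    ∑ i, ((x i).2 / (E.noiseVar (x i).1 : ℝ)) • E.C (x i).1)) 0

/-- The belief history generated by the data: its entry at time `s` is the posterior mean of `θ_1`
and the division vector after the first `s` observations. -/
noncomputable def beliefs [NeZero K] {t : ℕ} (x : Data K t) : Hist K t := fun s =>
  let p : Data K s := fun i => x (i.castLE (Nat.lt_succ_iff.mp s.isLt))
  (E.postMean p, counts p)

end Environment

/-! ### Strategies -/

/-- An information acquisition strategy: a measurable map that assigns to every belief history up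
to time `t` the source observed in period `t + 1`.  It may depend on a private randomization
device, the `Seed`, drawn at the outset independently of everything else; a non-random strategy is
one with a one-point `Seed`. -/
structure InfoStrategy (K : ℕ) where
  Seed : Type
  [mSeed : MeasurableSpace Seed]
  seedLaw : Measure Seed
  [isProb : IsProbabilityMeasure seedLaw]
  choose : ∀ t : ℕ, Seed × Hist K t → Fin K
  measurable_choose : ∀ t, Measurable (choose t)

attribute [instance] InfoStrategy.mSeed InfoStrategy.isProb

/-- A decision strategy paired with `S`: a measurable map from belief histories up to time `t + 1`
(and the realization of the device) to the action of period `t + 1`, an element of `Act t`. -/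
structure DecisionStrategy {K : ℕ} (S : InfoStrategy K) (Act : ℕ → Type*)
    [∀ t, MeasurableSpace (Act t)] where
  act : ∀ t : ℕ, S.Seed × Hist K (t + 1) → Act t
  measurable_act : ∀ t, Measurable (act t)

namespace InfoStrategy

variable {K : ℕ} [NeZero K] (E : Environment K) (S : InfoStrategy K)

/-- A sample point: the state vector, the noise `ε t k` of source `k` in period `t + 1`, and the
realization of the device. -/
abbrev Sample (S : InfoStrategy K) : Type :=
  EuclideanSpace ℝ (Fin K) × (ℕ → Fin K → ℝ) × S.Seed

/-- State, noises and device are independent with their respective laws. -/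
noncomputable def prob : Measure S.Sample :=
  (multivariateGaussian E.priorMean E.priorCov).prod
    ((Measure.infinitePi fun _ : ℕ => Measure.pi fun k : Fin K => gaussianReal 0 (E.noiseVar k)).prod
      S.seedLaw)

/-- The data generated by following `S` in the environment. -/
noncomputable def data (ω : S.Sample) : ∀ t : ℕ, Data K t
  | 0 => Fin.elim0
  | t + 1 =>
    let k : Fin K := S.choose t (ω.2.2, E.beliefs (data ω t))
    Fin.snoc (α := fun _ => Fin K × ℝ) (data ω t) (k, ∑ j, E.C k j * ω.1 j + ω.2.1 t k)

/-- The belief history up to time `T` generated by following `S`. -/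
noncomputable def hist (T : ℕ) (ω : S.Sample) : Hist K T := E.beliefs (S.data E ω T)

/-- The law of the belief history up to time `T` under `S`. -/
noncomputable def law (T : ℕ) : Measure (Hist K T) := (S.prob E).map (S.hist E T)

/-- A sequence of divisions is realized under `S` if it occurs with positive probability. -/
def Realized {T : ℕ} (δ : DivSeq K T) : Prop := S.law E T {h | divs h = δ} ≠ 0

/-- The realized payoff `U(a_1, a_2, …; θ_1)` under `(S, A)`. -/
noncomputable def payoff {Act : ℕ → Type*} [∀ t, MeasurableSpace (Act t)]
    (A : DecisionStrategy S Act) (U : (∀ t, Act t) × ℝ → ℝ) (ω : S.Sample) : ℝ :=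
  U (fun t => A.act t (ω.2.2, S.hist E (t + 1) ω), ω.1 0)

/-- The expected payoff under `(S, A)` as an extended real, `E[U⁺] - E[U⁻]`; it is `-∞` if both
terms are infinite, the convention of subtraction in `EReal`. -/
noncomputable def expectedPayoff {Act : ℕ → Type*} [∀ t, MeasurableSpace (Act t)]
    (A : DecisionStrategy S Act) (U : (∀ t, Act t) × ℝ → ℝ) : EReal :=
  ((∫⁻ ω, ENNReal.ofReal (S.payoff E A U ω) ∂(S.prob E) : ℝ≥0∞) : EReal) -
    ((∫⁻ ω, ENNReal.ofReal (-S.payoff E A U ω) ∂(S.prob E) : ℝ≥0∞) : EReal)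

end InfoStrategy

/-! ### Measurability of the belief histories (so that their laws are not degenerate) -/

theorem measurable_counts {K t : ℕ} : Measurable (counts : Data K t → Division K) := by
  have h : (counts : Data K t → Division K) =
      (fun c : Fin t → Fin K => fun k => (Finset.univ.filter fun i => c i = k).card) ∘
        (fun x : Data K t => fun i => (x i).1) := rfl
  rw [h]
  exact (measurable_of_countable _).comp (by fun_prop)

theorem Environment.measurable_postMean {K : ℕ} [NeZero K] (E : Environment K) {t : ℕ} :
    Measurable (E.postMean : Data K t → ℝ) := by
  unfold Environment.postMean
  simp only [Matrix.mulVec, dotProduct, Pi.add_apply, Finset.sum_apply, Pi.smul_apply, smul_eq_mul]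
  refine Finset.measurable_sum _ fun j _ => Measurable.mul ?_ ?_
  · exact (measurable_of_countable fun q : Division K => E.postCov q 0 j).comp measurable_counts
  · refine Measurable.add measurable_const (Finset.measurable_sum _ fun i _ => ?_)
    have h1 : Measurable fun x : Data K t => (x i).1 := by fun_prop
    have h2 : Measurable fun x : Data K t => (x i).2 := by fun_prop
    exact (h2.div ((measurable_of_countable fun k => (E.noiseVar k : ℝ)).comp h1)).mul
      ((measurable_of_countable fun k => E.C k j).comp h1)

theorem Environment.measurable_beliefs {K : ℕ} [NeZero K] (E : Environment K) {t : ℕ} :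
    Measurable (E.beliefs : Data K t → Hist K t) := by
  refine measurable_pi_lambda _ fun s => ?_
  have h : Measurable fun x : Data K t =>
      (fun i => x (i.castLE (Nat.lt_succ_iff.mp s.isLt)) : Data K s) := by fun_prop
  exact (E.measurable_postMean.comp h).prodMk (measurable_counts.comp h)

theorem InfoStrategy.measurable_data {K : ℕ} [NeZero K] (E : Environment K) (S : InfoStrategy K)
    (t : ℕ) : Measurable fun ω : S.Sample => S.data E ω t := by
  induction t with
  | zero => exact measurable_pi_lambda _ fun i => i.elim0
  | succ t ih =>
    have hk : Measurable fun ω : S.Sample => S.choose t (ω.2.2, E.beliefs (S.data E ω t)) :=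
      (S.measurable_choose t).comp
        ((measurable_snd.comp measurable_snd).prodMk (E.measurable_beliefs.comp ih))
    have hx : Measurable fun p : Fin K × S.Sample =>
        ∑ j, E.C p.1 j * p.2.1 j + p.2.2.1 t p.1 := by
      refine measurable_from_prod_countable_right fun k => ?_
      have h1 : ∀ j, Measurable fun ω : S.Sample => ω.1 j := fun j => by fun_prop
      have h2 : Measurable fun ω : S.Sample => ω.2.1 t k :=
        (measurable_pi_apply k).comp ((measurable_pi_apply t).comp
          (measurable_fst.comp measurable_snd))
      exact (Finset.measurable_sum _ fun j _ => (h1 j).const_mul (E.C k j)).add h2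
    refine measurable_pi_lambda _ fun i => ?_
    refine Fin.lastCases ?_ (fun i => ?_) i
    · simp only [InfoStrategy.data, Fin.snoc_last]
      exact hk.prodMk (hx.comp (hk.prodMk measurable_id))
    · simp only [InfoStrategy.data, Fin.snoc_castSucc]
      exact (measurable_pi_apply i).comp ih

theorem InfoStrategy.measurable_hist {K : ℕ} [NeZero K] (E : Environment K) (S : InfoStrategy K)
    (T : ℕ) : Measurable (S.hist E T) :=
  E.measurable_beliefs.comp (S.measurable_data E T)

end DynamicInfo

open DynamicInfo

/-! ### Integrals against the standard normal law -/

/-! Under any strategy, given the seed and the history, the posterior mean μ moves by a centred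
normal step of variance f(d(t)) - f(d(t+1)), and θ₁ is normal around μ with variance f(d(t))
(`lintegral_next_mean`, `lintegral_state`). Lower posterior variance thus means a mean ν that has
run further along the same kind of Gaussian walk, and a path of μ can be recovered from ν by adding
noise.

The simulating strategy does this online. Its seed consists of the seed of `S` and i.i.d. standard
normal innovations, and it keeps a fictitious history of `S`. From this history it knows the source
`S` would choose next, hence d(t+1), and it observes the source that `G` then dictates. On seeing
ν(t+1), it draws the fictitious μ(t+1) from the Gaussian bridge between μ(t) and ν(t+1), with
variances A = f(d(t)) - f(d(t+1)) for the first leg and C = f(d(t+1)) - f(d̃(t+1)) for the second.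
The invariant (`lintegral_simulator`) is that seed and fictitious history have their law under `S`,
and that given them ν(t) is normal around μ(t) with variance f(d(t)) - f(d̃(t)). It survives a step
because this variance plus that of the step of ν equals A + C, and because a walk may be drawn
endpoint first and midpoint second (`lintegral_bridge`, `lintegral_extend_bridge`).

Given everything the simulator knows, θ₁ is normal around ν(t) with variance f(d̃(t)). Adding the
two variances shows that seed, fictitious history and θ₁ are distributed jointly as under `S`
(`map_simHist_state`), for all periods at once (`map_simHist_state_all`). Playing `A` at the
fictitious history therefore yields exactly the payoff of `(S, A)`. The kernels of the association
are the two disintegrations of the joint law of fictitious and actual history.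

The seed space carries no regularity assumption, so conditional laws involving the seed are
expressed as identities between iterated integrals; regular conditional kernels appear only on the
history spaces. -/

theorem map_affine_stdNormal (m v : ℝ) :
    (gaussianReal 0 1).map (fun z => m + √v * z) = gaussianReal m v.toNNReal := by
  have h : (fun z : ℝ => m + √v * z) = (fun y => m + y) ∘ fun z => √v * z := rfl
  rw [h, ← Measure.map_map (by fun_prop) (by fun_prop), gaussianReal_map_const_mul,
    gaussianReal_map_const_add]
  congr 1
  · simp
  · ext
    -- No sign condition is needed: for negative `v` both `√v` and `v.toNNReal` are zero.
    rcases le_total 0 v with hv | hv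
    · simp [Real.sq_sqrt hv, Real.coe_toNNReal _ hv]
    · simp [Real.sqrt_eq_zero_of_nonpos hv, Real.toNNReal_of_nonpos hv]

theorem lintegral_gaussianReal (m v : ℝ) {φ : ℝ → ℝ≥0∞} (hφ : Measurable φ) :
    ∫⁻ y, φ y ∂(gaussianReal m v.toNNReal) = ∫⁻ z, φ (m + √v * z) ∂(gaussianReal 0 1) := by
  rw [← map_affine_stdNormal, lintegral_map hφ (by fun_prop)]

theorem lintegral_stdNormal_rotate {a b : ℝ} (hab : a ^ 2 + b ^ 2 = 1) {φ : ℝ × ℝ → ℝ≥0∞}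
    (hφ : Measurable φ) :
    ∫⁻ x, ∫⁻ y, φ (a * x + b * y, -b * x + a * y) ∂(gaussianReal 0 1) ∂(gaussianReal 0 1) =
      ∫⁻ x, ∫⁻ y, φ (x, y) ∂(gaussianReal 0 1) ∂(gaussianReal 0 1) := by
  obtain ⟨θ, h1, h2⟩ : ∃ θ, Real.cos θ = a ∧ Real.sin θ = b := by
    have hn : ‖(⟨a, b⟩ : ℂ)‖ = 1 := by
      rw [Complex.norm_eq_sqrt_sq_add_sq]; simp [hab]
    have h0 : (⟨a, b⟩ : ℂ) ≠ 0 := by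
      intro h; simp [h] at hn
    exact ⟨Complex.arg ⟨a, b⟩, by rw [Complex.cos_arg h0, hn, div_one],
      by rw [Complex.sin_arg, hn, div_one]⟩
  rw [← lintegral_prod _ hφ.aemeasurable,
    ← lintegral_prod (fun p : ℝ × ℝ => φ (a * p.1 + b * p.2, -b * p.1 + a * p.2))
      (by fun_prop)]
  conv_rhs => rw [← IsGaussian.map_rotation_eq_self (μ := gaussianReal 0 1) (by simp) θ,
    lintegral_map hφ (ContinuousLinearMap.measurable _)]
  simp [ContinuousLinearMap.rotation_apply, h1, h2]

/-- Drawing the later value of a Gaussian random walk first and then the earlier one from the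
Gaussian bridge is the same as drawing the two successively. -/
theorem lintegral_bridge {A C : ℝ} (hA : 0 ≤ A) (hC : 0 ≤ C) {φ : ℝ × ℝ → ℝ≥0∞}
    (hφ : Measurable φ) :
    ∫⁻ z, ∫⁻ e, φ (A / (A + C) * (√(A + C) * z) - √(A * C / (A + C)) * e, √(A + C) * z)
        ∂(gaussianReal 0 1) ∂(gaussianReal 0 1) =
      ∫⁻ x, ∫⁻ y, φ (√A * x, √A * x + √C * y) ∂(gaussianReal 0 1) ∂(gaussianReal 0 1) := by
  -- If both variances vanish, division by zero gives zero and both sides are the value of φ at the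
  -- origin.
  rcases eq_or_lt_of_le (add_nonneg hA hC) with h | h
  · have hA0 : A = 0 := by linarith
    have hC0 : C = 0 := by linarith
    simp [hA0, hC0]
  have hs : √(A + C) ≠ 0 := (Real.sqrt_pos.2 h).ne'
  have hs2 := Real.sq_sqrt h.le
  have hA2 := Real.sq_sqrt hA
  have hC2 := Real.sq_sqrt hC
  -- The rotation makes the standardized sum (√A x + √C y) / √(A + C) the new coordinate z; the
  -- orthogonal coordinate e is the bridge innovation.
  have hab : (√A / √(A + C)) ^ 2 + (-(√C / √(A + C))) ^ 2 = 1 := by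
    rw [neg_sq, div_pow, div_pow, hs2, hA2, hC2, ← add_div, div_self h.ne']
  rw [← lintegral_stdNormal_rotate hab
    (φ := fun p => φ (√A * p.1, √A * p.1 + √C * p.2)) (by fun_prop)]
  refine lintegral_congr fun z => lintegral_congr fun e => ?_
  congr 2
  · rw [Real.sqrt_div (mul_nonneg hA hC), Real.sqrt_mul hA]
    have h1 : A / (A + C) * √(A + C) = A / √(A + C) := by
      field_simp; rw [hs2]
    rw [← mul_assoc, h1]
    field_simp
    linear_combination (-z) * hA2
  · field_simp
    rw [hs2]
    linear_combination (-z) * hA2 - z * hC2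

theorem lintegral_stdNormal_add {A C : ℝ} (hA : 0 ≤ A) (hC : 0 ≤ C) {φ : ℝ → ℝ≥0∞}
    (hφ : Measurable φ) :
    ∫⁻ x, ∫⁻ y, φ (√A * x + √C * y) ∂(gaussianReal 0 1) ∂(gaussianReal 0 1) =
      ∫⁻ z, φ (√(A + C) * z) ∂(gaussianReal 0 1) := by
  have h := lintegral_bridge hA hC (φ := fun p => φ p.2) (by fun_prop)
  simpa using h.symm

/-! ### Resampling one coordinate of an infinite product -/

/-- Checked on finite boxes: if `t` is a constrained index, the fresh draw supplies its factor and
the old coordinate is free; otherwise the draw does not matter. It serves to make the innovation of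
one period visibly independent of the past. -/
theorem map_update_infinitePi {X : ℕ → Type*} [∀ i, MeasurableSpace (X i)]
    (μ : ∀ i, Measure (X i)) [∀ i, IsProbabilityMeasure (μ i)] (t : ℕ) :
    ((Measure.infinitePi μ).prod (μ t)).map (fun p => Function.update p.1 t p.2) =
      Measure.infinitePi μ := by
  have hm : Measurable fun p : (∀ i, X i) × X t => Function.update p.1 t p.2 := by
    refine measurable_pi_lambda _ fun i => ?_
    by_cases h : i = t
    · subst h; simpa using measurable_snd
    · simp only [Function.update_of_ne h]; fun_prop
  refine Measure.eq_infinitePi _ fun s B hB => ?_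
  rw [Measure.map_apply hm (MeasurableSet.pi s.countable_toSet fun i _ => hB i)]
  by_cases hts : t ∈ s
  · have h : (fun p : (∀ i, X i) × X t => Function.update p.1 t p.2) ⁻¹' (s : Set ℕ).pi B =
        ((s.erase t : Finset ℕ) : Set ℕ).pi B ×ˢ B t := by
      ext ⟨x, y⟩
      simp only [Set.mem_preimage, Set.mem_pi, Finset.mem_coe, Set.mem_prod, Finset.mem_erase]
      constructor
      · intro h
        exact ⟨fun i hi => by simpa [hi.1] using h i hi.2, by simpa using h t hts⟩
      · rintro ⟨h1, h2⟩ i hi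
        by_cases hit : i = t
        · subst hit; simpa using h2
        · simpa [hit] using h1 i ⟨hit, hi⟩
    rw [h, Measure.prod_prod, Measure.infinitePi_pi _ (fun i _ => hB i), mul_comm,
      Finset.mul_prod_erase s (fun i => μ i (B i)) hts]
  · have h : (fun p : (∀ i, X i) × X t => Function.update p.1 t p.2) ⁻¹' (s : Set ℕ).pi B =
        (s : Set ℕ).pi B ×ˢ Set.univ := by
      ext ⟨x, y⟩
      simp only [Set.mem_preimage, Set.mem_pi, Finset.mem_coe, Set.mem_prod, Set.mem_univ,
        and_true]
      refine forall₂_congr fun i hi => ?_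
      have hit : i ≠ t := fun h => hts (h ▸ hi)
      simp [hit]
    rw [h, Measure.prod_prod, Measure.infinitePi_pi _ (fun i _ => hB i)]
    simp

theorem lintegral_update_infinitePi {X : ℕ → Type*} [∀ i, MeasurableSpace (X i)]
    (μ : ∀ i, Measure (X i)) [∀ i, IsProbabilityMeasure (μ i)] (t : ℕ)
    {φ : (∀ i, X i) → ℝ≥0∞} (hφ : Measurable φ) :
    ∫⁻ x, φ x ∂(Measure.infinitePi μ) =
      ∫⁻ x, ∫⁻ y, φ (Function.update x t y) ∂(μ t) ∂(Measure.infinitePi μ) := by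
  have hm : Measurable fun p : (∀ i, X i) × X t => Function.update p.1 t p.2 := by
    refine measurable_pi_lambda _ fun i => ?_
    by_cases h : i = t
    · subst h; simpa using measurable_snd
    · simp only [Function.update_of_ne h]; fun_prop
  conv_lhs => rw [← map_update_infinitePi μ t, lintegral_map hφ hm]
  exact lintegral_prod _ (hφ.comp hm).aemeasurable

/-! ### Posterior variances decrease in the number of observations -/

namespace DynamicInfo.Environment

variable {K : ℕ} (E : Environment K)

/-- The posterior precision matrix. -/
noncomputable def precision (q : Division K) : Matrix (Fin K) (Fin K) ℝ :=
  E.priorCov⁻¹ + E.Cᵀ * Matrix.diagonal (fun i => (q i : ℝ) / E.noiseVar i) * E.C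

theorem precision_posDef (q : Division K) : (E.precision q).PosDef := by
  refine E.priorCov_posDef.inv.add_posSemidef ?_
  have h : (Matrix.diagonal fun i => (q i : ℝ) / E.noiseVar i).PosSemidef :=
    Matrix.PosSemidef.diagonal fun i => by positivity
  simpa using h.conjTranspose_mul_mul_same E.C

theorem isUnit_det_precision (q : Division K) : IsUnit (E.precision q).det :=
  (Matrix.isUnit_iff_isUnit_det _).1 (E.precision_posDef q).isUnit

theorem precision_mul_postCov (q : Division K) : E.precision q * E.postCov q = 1 :=
  Matrix.mul_nonsing_inv _ (E.isUnit_det_precision q)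

theorem postCov_posDef (q : Division K) : (E.postCov q).PosDef := (E.precision_posDef q).inv

theorem f_nonneg [NeZero K] (q : Division K) : 0 ≤ E.f q :=
  (E.postCov_posDef q).posSemidef.diag_nonneg

theorem dotProduct_precision_mulVec (q : Division K) (u : Fin K → ℝ) :
    u ⬝ᵥ E.precision q *ᵥ u = u ⬝ᵥ E.priorCov⁻¹ *ᵥ u +
      ∑ i, (q i : ℝ) / E.noiseVar i * (E.C *ᵥ u) i ^ 2 := by
  rw [precision, Matrix.add_mulVec, dotProduct_add, ← Matrix.mulVec_mulVec,
    ← Matrix.mulVec_mulVec, Matrix.dotProduct_mulVec u E.Cᵀ, Matrix.vecMul_transpose]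
  congr 1
  simp only [dotProduct, Matrix.mulVec_diagonal]
  exact Finset.sum_congr rfl fun i _ => by ring

/-- Let P(q) be the precision, e the first unit vector, u = P(r)⁻¹e and w = P(q)⁻¹e. Expanding 0 ≤
(u - w)'P(q)(u - w) gives 2u'e ≤ u'P(q)u + w'e, and u'P(q)u ≤ u'P(r)u = u'e because counts enter the
quadratic form monotonically. -/
theorem f_antitone [NeZero K] : Antitone E.f := by
  intro q r hqr
  set e : Fin K → ℝ := Pi.single 0 1
  set u := E.postCov r *ᵥ e
  set w := E.postCov q *ᵥ e
  have hu : E.precision r *ᵥ u = e := by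
    simp [u, Matrix.mulVec_mulVec, precision_mul_postCov]
  have hw : E.precision q *ᵥ w = e := by
    simp [w, Matrix.mulVec_mulVec, precision_mul_postCov]
  have hfr : E.f r = u ⬝ᵥ e := by simp [u, e, f]
  have hfq : E.f q = w ⬝ᵥ e := by simp [w, e, f]
  have hle : u ⬝ᵥ E.precision q *ᵥ u ≤ u ⬝ᵥ E.precision r *ᵥ u := by
    rw [dotProduct_precision_mulVec, dotProduct_precision_mulVec]
    gcongr with i
    exact_mod_cast hqr i
  rw [hu] at hle
  have h0 : 0 ≤ (u - w) ⬝ᵥ E.precision q *ᵥ (u - w) := by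
    simpa using (E.precision_posDef q).posSemidef.dotProduct_mulVec_nonneg (u - w)
  have hsym : w ⬝ᵥ E.precision q *ᵥ u = u ⬝ᵥ e := by
    have ht : (E.precision q)ᵀ = E.precision q := by
      simpa using (E.precision_posDef q).isHermitian.eq
    rw [Matrix.dotProduct_mulVec, ← Matrix.mulVec_transpose, ht, hw, dotProduct_comm]
  rw [Matrix.mulVec_sub, sub_dotProduct, dotProduct_sub, dotProduct_sub, hw, hsym] at h0
  rw [hfr, hfq]
  linarith

end DynamicInfo.Environment

/-! ### Linear functionals of a Gaussian state and independent Gaussian noises -/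

theorem isGaussian_pi_gaussianReal {n : ℕ} (w : Fin n → ℝ≥0) :
    IsGaussian (Measure.pi fun i => gaussianReal 0 (w i)) := by
  have h1 : iIndepFun (fun (i : Fin n) (ω : Fin n → ℝ) => ω i)
      (Measure.pi fun i => gaussianReal 0 (w i)) :=
    iIndepFun_pi (X := fun _ x => x) fun i => aemeasurable_id
  have h2 : ∀ i, HasGaussianLaw (fun ω : Fin n → ℝ => ω i)
      (Measure.pi fun i => gaussianReal 0 (w i)) := fun i =>
    ⟨by
      have := (measurePreserving_eval (fun i => gaussianReal 0 (w i)) i).map_eq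
      change IsGaussian (Measure.map (fun ω : Fin n → ℝ => ω i) _)
      rw [show (fun ω : Fin n → ℝ => ω i) = Function.eval i from rfl, this]
      infer_instance⟩
  simpa using (iIndepFun.hasGaussianLaw h2 h1).isGaussian_map

/-- The law of a Gaussian state vector together with independent centred Gaussian noises. -/
noncomputable def stateNoiseLaw {K n : ℕ} (m : EuclideanSpace ℝ (Fin K))
    (V : Matrix (Fin K) (Fin K) ℝ) (w : Fin n → ℝ≥0) :
    Measure (EuclideanSpace ℝ (Fin K) × (Fin n → ℝ)) :=
  (multivariateGaussian m V).prod (Measure.pi fun i => gaussianReal 0 (w i))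

/-- The linear functional `(θ, ε) ↦ ⟨a, θ⟩ + ⟨b, ε⟩`. -/
def linFun {K n : ℕ} (a : Fin K → ℝ) (b : Fin n → ℝ)
    (ω : EuclideanSpace ℝ (Fin K) × (Fin n → ℝ)) : ℝ :=
  ∑ j, a j * ω.1 j + ∑ i, b i * ω.2 i

section

variable {K n : ℕ} (m : EuclideanSpace ℝ (Fin K)) {V : Matrix (Fin K) (Fin K) ℝ}
  (w : Fin n → ℝ≥0)

instance (V : Matrix (Fin K) (Fin K) ℝ) : IsGaussian (stateNoiseLaw m V w) := by
  have := isGaussian_pi_gaussianReal w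
  unfold stateNoiseLaw; infer_instance

@[fun_prop]
theorem measurable_linFun (a : Fin K → ℝ) (b : Fin n → ℝ) : Measurable (linFun a b) := by
  unfold linFun; fun_prop

theorem linFun_add (a : Fin K → ℝ) (b : Fin n → ℝ) (x y) :
    linFun a b (x + y) = linFun a b x + linFun a b y := by
  simp only [linFun, Prod.fst_add, Prod.snd_add, PiLp.add_apply, Pi.add_apply, mul_add,
    Finset.sum_add_distrib]
  ring

theorem linFun_smul (a : Fin K → ℝ) (b : Fin n → ℝ) (r : ℝ) (x) :
    linFun a b (r • x) = r * linFun a b x := by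
  simp only [linFun, Prod.smul_fst, Prod.smul_snd, PiLp.smul_apply, Pi.smul_apply, smul_eq_mul,
    mul_add, Finset.mul_sum]
  congr 1 <;> exact Finset.sum_congr rfl fun i _ => by ring

/-- The second component is a family over `Unit` to fit the criterion, stated for two families, by
which jointly Gaussian and uncorrelated implies independent. -/
theorem hasGaussianLaw_linFun_prod (V : Matrix (Fin K) (Fin K) ℝ) {t : ℕ}
    (a : Fin t → Fin K → ℝ) (b : Fin t → Fin n → ℝ) (a' : Fin K → ℝ) (b' : Fin n → ℝ) :
    HasGaussianLaw (fun ω => ((fun i => linFun (a i) (b i) ω), fun _ : Unit => linFun a' b' ω))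
      (stateNoiseLaw m V w) := by
  let L : (EuclideanSpace ℝ (Fin K) × (Fin n → ℝ)) →ₗ[ℝ] (Fin t → ℝ) × (Unit → ℝ) :=
    { toFun := fun ω => ((fun i => linFun (a i) (b i) ω), fun _ : Unit => linFun a' b' ω)
      map_add' := fun x y => by ext <;> simp [linFun_add]
      map_smul' := fun r x => by ext <;> simp [linFun_smul] }
  exact (IsGaussian.hasGaussianLaw_id (μ := stateNoiseLaw m V w)).map L.toContinuousLinearMap

theorem hasGaussianLaw_linFun (V : Matrix (Fin K) (Fin K) ℝ) (a : Fin K → ℝ) (b : Fin n → ℝ) :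
    HasGaussianLaw (linFun a b) (stateNoiseLaw m V w) :=
  (hasGaussianLaw_linFun_prod m w V (t := 0) (fun _ => a) (fun _ => b) a b).snd.eval ()

theorem covariance_linFun (hV : V.PosSemidef) (a a' : Fin K → ℝ) (b b' : Fin n → ℝ) :
    cov[linFun a b, linFun a' b'; stateNoiseLaw m V w] =
      a ⬝ᵥ V *ᵥ a' + ∑ i, b i * b' i * w i := by
  have := isGaussian_pi_gaussianReal w
  set G := multivariateGaussian m V with hG
  set N := Measure.pi fun i => gaussianReal 0 (w i) with hN
  -- States and noises form one family over a sum type, so bilinearity is used once; the mixed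
  -- covariances vanish by independence.
  let W : Fin K ⊕ Fin n → (EuclideanSpace ℝ (Fin K) × (Fin n → ℝ)) → ℝ :=
    Sum.elim (fun j ω => ω.1 j) (fun i ω => ω.2 i)
  have hlin : ∀ (a : Fin K → ℝ) (b : Fin n → ℝ), linFun a b = fun ω =>
      ∑ s, Sum.elim a b s * W s ω := by
    intro a b; funext ω; simp [linFun, W]
  have hW : ∀ s, MemLp (W s) 2 (stateNoiseLaw m V w) := by
    rintro (j | i)
    · have h := hasGaussianLaw_linFun m w V (Pi.single j 1) 0
      have h2 : linFun (Pi.single j 1) (0 : Fin n → ℝ) = W (Sum.inl j) := by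
        funext ω; simp [linFun, W, Pi.single_apply]
      rw [h2] at h
      exact h.memLp_two
    · have h := hasGaussianLaw_linFun m w V 0 (Pi.single i 1)
      have h2 : linFun (0 : Fin K → ℝ) (Pi.single i 1) = W (Sum.inr i) := by
        funext ω; simp [linFun, W, Pi.single_apply]
      rw [h2] at h
      exact h.memLp_two
  have hθ : ∀ j j', cov[W (Sum.inl j), W (Sum.inl j'); stateNoiseLaw m V w] = V j j' := by
    intro j j'
    rw [← covariance_eval_multivariateGaussian (μ := m) hV j j']
    conv_rhs => rw [← hG, ← (measurePreserving_fst (μ := G) (ν := N)).map_eq]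
    rw [covariance_map_fun (by fun_prop) (by fun_prop) (by fun_prop)]
    rfl
  have hθε : ∀ j i, cov[W (Sum.inl j), W (Sum.inr i); stateNoiseLaw m V w] = 0 := by
    intro j i
    refine IndepFun.covariance_eq_zero ?_ (hW _) (hW _)
    exact indepFun_prod (μ := G) (ν := N) (X := fun θ => θ j) (Y := fun ε => ε i)
      (by fun_prop) (by fun_prop)
  have hε : ∀ i i', cov[W (Sum.inr i), W (Sum.inr i'); stateNoiseLaw m V w] =
      if i = i' then (w i : ℝ) else 0 := by
    intro i i'
    split_ifs with h
    · subst h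
      have h3 : MeasurePreserving (fun ω : EuclideanSpace ℝ (Fin K) × (Fin n → ℝ) => ω.2 i)
          (stateNoiseLaw m V w) (gaussianReal 0 (w i)) :=
        (measurePreserving_eval (fun i => gaussianReal 0 (w i)) i).comp
          (measurePreserving_snd (μ := G) (ν := N))
      rw [covariance_self (hW _).aestronglyMeasurable.aemeasurable,
        ← variance_id_gaussianReal (μ := 0) (v := w i), ← h3.map_eq,
        variance_map (by fun_prop) (by fun_prop)]
      rfl
    · refine IndepFun.covariance_eq_zero ?_ (hW _) (hW _)
      have h1 : iIndepFun (fun (i : Fin n) (ω : Fin n → ℝ) => ω i) N :=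
        iIndepFun_pi (X := fun _ x => x) fun i => aemeasurable_id
      have h2 := h1.indepFun h
      rw [← (measurePreserving_snd (μ := G) (ν := N)).map_eq] at h2
      rw [indepFun_iff_map_prod_eq_prod_map_map (measurable_pi_apply _).aemeasurable
        (measurable_pi_apply _).aemeasurable] at h2
      rw [indepFun_iff_map_prod_eq_prod_map_map (hW _).aestronglyMeasurable.aemeasurable
        (hW _).aestronglyMeasurable.aemeasurable]
      rw [Measure.map_map (by fun_prop) (by fun_prop), Measure.map_map (by fun_prop) (by fun_prop),
        Measure.map_map (by fun_prop) (by fun_prop)] at h2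
      exact h2
  rw [hlin a b, hlin a' b', covariance_fun_sum_fun_sum (fun s => (hW s).const_mul _)
    (fun s => (hW s).const_mul _)]
  simp only [covariance_const_mul_left, covariance_const_mul_right, Fintype.sum_sum_type,
    Sum.elim_inl, Sum.elim_inr, hθ, hθε, hε, covariance_comm (W (Sum.inr _)) (W (Sum.inl _))]
  simp only [mul_zero, Finset.sum_const_zero, add_zero, zero_add, dotProduct, Matrix.mulVec,
    Finset.mul_sum]
  congr 1
  · exact Finset.sum_congr rfl fun i _ => Finset.sum_congr rfl fun j _ => by ring
  · refine Finset.sum_congr rfl fun i _ => ?_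
    simp; ring

theorem integral_linFun (V : Matrix (Fin K) (Fin K) ℝ) (a : Fin K → ℝ) (b : Fin n → ℝ) :
    ∫ ω, linFun a b ω ∂(stateNoiseLaw m V w) = ∑ j, a j * m j := by
  have := isGaussian_pi_gaussianReal w
  have h0 : ∫ ω, ω ∂(stateNoiseLaw m V w) = (m, 0) := by
    have hint : Integrable (fun ω => ω) (stateNoiseLaw m V w) :=
      IsGaussian.integrable_id
    have hpi : ∫ ω : Fin n → ℝ, ω ∂(Measure.pi fun i => gaussianReal 0 (w i)) = 0 := by
      ext i
      have h5 := ContinuousLinearMap.integral_comp_comm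
        (ContinuousLinearMap.proj (R := ℝ) (φ := fun _ : Fin n => ℝ) i)
        (IsGaussian.integrable_id (μ := Measure.pi fun i => gaussianReal 0 (w i)))
      have h3 := measurePreserving_eval (fun i => gaussianReal 0 (w i)) i
      have h4 := integral_map (μ := Measure.pi fun i => gaussianReal 0 (w i)) h3.aemeasurable
        (f := fun x : ℝ => x) (by fun_prop)
      rw [h3.map_eq, integral_id_gaussianReal] at h4
      exact h5.symm.trans h4.symm
    ext1
    · have h1 := ContinuousLinearMap.integral_comp_comm
        (ContinuousLinearMap.fst ℝ (EuclideanSpace ℝ (Fin K)) (Fin n → ℝ)) hint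
      simp only [ContinuousLinearMap.coe_fst'] at h1
      rw [← h1, stateNoiseLaw, integral_fun_fst (fun x : EuclideanSpace ℝ (Fin K) => x)]
      simp
    · have h1 := ContinuousLinearMap.integral_comp_comm
        (ContinuousLinearMap.snd ℝ (EuclideanSpace ℝ (Fin K)) (Fin n → ℝ)) hint
      simp only [ContinuousLinearMap.coe_snd'] at h1
      rw [← h1, stateNoiseLaw, integral_fun_snd (fun x : Fin n → ℝ => x), hpi]
      simp
  let L : (EuclideanSpace ℝ (Fin K) × (Fin n → ℝ)) →ₗ[ℝ] ℝ :=
    { toFun := linFun a b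
      map_add' := linFun_add a b
      map_smul' := linFun_smul a b }
  have h := ContinuousLinearMap.integral_comp_comm L.toContinuousLinearMap
    (IsGaussian.integrable_id (μ := stateNoiseLaw m V w))
  change ∫ ω, linFun a b ω ∂_ = linFun a b (∫ ω, ω ∂_) at h
  rw [h, h0]
  simp [linFun]

/-- Gaussian regression: a linear functional that is uncorrelated with the observations, `Y`, is
independent of them, so that `Y + M` given the observations is normal around `M`. -/
theorem lintegral_linFun_regression {t : ℕ} {β : Type*} [MeasurableSpace β]
    (a : Fin t → Fin K → ℝ) (b : Fin t → Fin n → ℝ) (a' : Fin K → ℝ) (b' : Fin n → ℝ)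
    (hcov : ∀ i, cov[linFun (a i) (b i), linFun a' b'; stateNoiseLaw m V w] = 0)
    (g : (Fin t → ℝ) → β) (hg : Measurable g) {φ : β × ℝ → ℝ≥0∞} (hφ : Measurable φ) :
    ∫⁻ ω, φ (g fun i => linFun (a i) (b i) ω, linFun a' b' ω - ∑ j, a' j * m j)
        ∂(stateNoiseLaw m V w) =
      ∫⁻ ω, ∫⁻ z, φ (g fun i => linFun (a i) (b i) ω,
        √(cov[linFun a' b', linFun a' b'; stateNoiseLaw m V w]) * z) ∂(gaussianReal 0 1)
        ∂(stateNoiseLaw m V w) := by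
  have hind := (hasGaussianLaw_linFun_prod m w V a b a' b').indepFun_of_covariance_eval
    fun i _ => hcov i
  have hind2 : IndepFun (fun ω i => linFun (a i) (b i) ω) (linFun a' b') (stateNoiseLaw m V w) :=
    hind.comp (φ := id) (ψ := fun y : Unit → ℝ => y ()) measurable_id (measurable_pi_apply _)
  rw [indepFun_iff_map_prod_eq_prod_map_map (by fun_prop) (by fun_prop),
    (hasGaussianLaw_linFun m w V a' b').map_eq_gaussianReal, integral_linFun] at hind2
  have hψ : Measurable fun p : (Fin t → ℝ) × ℝ => φ (g p.1, p.2 - ∑ j, a' j * m j) := by fun_prop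
  have h1 := lintegral_map (μ := stateNoiseLaw m V w) hψ
    (g := fun ω => (fun i => linFun (a i) (b i) ω, linFun a' b' ω)) (by fun_prop)
  rw [← h1, hind2, lintegral_prod _ hψ.aemeasurable]
  have hmeas : Measurable fun x : Fin t → ℝ => ∫⁻ z, φ (g x,
      √(cov[linFun a' b', linFun a' b'; stateNoiseLaw m V w]) * z) ∂(gaussianReal 0 1) := by
    refine Measurable.lintegral_prod_right' (f := fun p : (Fin t → ℝ) × ℝ =>
      φ (g p.1, √(cov[linFun a' b', linFun a' b'; stateNoiseLaw m V w]) * p.2)) ?_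
    fun_prop
  rw [← lintegral_map hmeas (g := fun ω i => linFun (a i) (b i) ω) (by fun_prop)]
  refine lintegral_congr fun x => ?_
  rw [covariance_self (by fun_prop), lintegral_gaussianReal _ _ (by fun_prop)]
  simp

end

/-! ### Posterior means along a fixed sequence of sources -/

theorem Fin.sum_univ_castLE {M : Type*} [AddCommMonoid M] {t n : ℕ} (h : t ≤ n) (g : Fin n → M) :
    ∑ i : Fin t, g (i.castLE h) = ∑ i : Fin n, if (i : ℕ) < t then g i else 0 := by
  rw [← Finset.sum_filter]
  refine Finset.sum_bij (fun i _ => i.castLE h) ?_ ?_ ?_ ?_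
  · intro i _; simp
  · intro i _ j _ hij; exact Fin.castLE_injective h hij
  · intro j hj
    exact ⟨⟨j, (Finset.mem_filter.1 hj).2⟩, Finset.mem_univ _, rfl⟩
  · intro i _; rfl

namespace DynamicInfo

/-- The first `t` entries of the data. -/
def Data.take {K t n : ℕ} (h : t ≤ n) (x : Data K n) : Data K t := fun i => x (i.castLE h)

@[fun_prop]
theorem Data.measurable_take {K t n : ℕ} (h : t ≤ n) : Measurable (Data.take (K := K) h) :=
  measurable_pi_lambda _ fun _ => measurable_pi_apply _

attribute [fun_prop] measurable_counts Environment.measurable_postMean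
  Environment.measurable_beliefs InfoStrategy.measurable_hist InfoStrategy.measurable_data

namespace Environment

variable {K : ℕ} (E : Environment K)

/-- Each observation of source k adds the rank-one term c_k c_k' / σ_k² to the precision; the sum
over sources is regrouped by observations. -/
theorem precision_counts_mulVec {t : ℕ} (x : Data K t) (p : Fin K → ℝ) :
    E.precision (counts x) *ᵥ p = E.priorCov⁻¹ *ᵥ p +
      ∑ i, ((p ⬝ᵥ E.C (x i).1) / E.noiseVar (x i).1) • E.C (x i).1 := by
  rw [precision, Matrix.add_mulVec, ← Matrix.mulVec_mulVec, ← Matrix.mulVec_mulVec]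
  congr 1
  funext j
  have hc : ∀ k, (counts x k : ℝ) = ∑ i, if (x i).1 = k then (1 : ℝ) else 0 := by
    intro k; simp [counts]
  rw [Matrix.mulVec, dotProduct]
  simp only [Matrix.transpose_apply, Matrix.mulVec_diagonal, hc, Finset.sum_apply, Pi.smul_apply,
    smul_eq_mul, Finset.sum_div, Finset.sum_mul, Finset.mul_sum]
  rw [Finset.sum_comm]
  refine Finset.sum_congr rfl fun i _ => ?_
  rw [Finset.sum_eq_single (x i).1]
  · rw [if_pos rfl, Matrix.mulVec, dotProduct_comm]; ring
  · intro k _ hk; simp [hk.symm]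
  · simp

/-- The data from observing the sources `k 0, k 1, …`, as a function of state and noises. -/
def pathData {n : ℕ} (k : Fin n → Fin K) (ω : EuclideanSpace ℝ (Fin K) × (Fin n → ℝ)) :
    Data K n := fun i => (k i, ∑ j, E.C (k i) j * ω.1 j + ω.2 i)

@[fun_prop]
theorem measurable_pathData {n : ℕ} (k : Fin n → Fin K) : Measurable (E.pathData k) := by
  unfold pathData; fun_prop

/-- How often each source occurs among the first `t` entries of a sequence. -/
def pathCounts {t n : ℕ} (h : t ≤ n) (k : Fin n → Fin K) : Division K :=
  counts (fun i : Fin t => (k (i.castLE h), (0 : ℝ)))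

theorem counts_take_pathData {t n : ℕ} (h : t ≤ n) (k : Fin n → Fin K) (ω) :
    counts ((E.pathData k ω).take h) = pathCounts h k := rfl

theorem priorCov_mul_inv : E.priorCov * E.priorCov⁻¹ = 1 :=
  Matrix.mul_nonsing_inv _ ((Matrix.isUnit_iff_isUnit_det _).1 E.priorCov_posDef.isUnit)

theorem priorCov_transpose : E.priorCovᵀ = E.priorCov := by
  simpa using E.priorCov_posDef.isHermitian.eq

theorem priorCov_inv_transpose : E.priorCov⁻¹ᵀ = E.priorCov⁻¹ := by
  rw [Matrix.transpose_nonsing_inv, priorCov_transpose]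

variable [NeZero K]

theorem postMean_eq {t : ℕ} (x : Data K t) :
    E.postMean x = E.postCov (counts x) 0 ⬝ᵥ E.priorCov⁻¹ *ᵥ (fun i => E.priorMean i) +
      ∑ i, (x i).2 * ((E.postCov (counts x) 0 ⬝ᵥ E.C (x i).1) / E.noiseVar (x i).1) := by
  rw [postMean, Matrix.mulVec, dotProduct_add, dotProduct_sum]
  congr 1
  refine Finset.sum_congr rfl fun i _ => ?_
  rw [dotProduct_smul, smul_eq_mul]; ring

theorem precision_mulVec_postCov_zero (q : Division K) :
    E.precision q *ᵥ E.postCov q 0 = Pi.single 0 1 := by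
  have hs : (E.postCov q)ᵀ = E.postCov q := by
    simpa using (E.postCov_posDef q).isHermitian.eq
  have h : E.postCov q 0 = E.postCov q *ᵥ Pi.single 0 1 := by
    rw [Matrix.mulVec_single_one]
    conv_lhs => rw [← hs]
    rfl
  rw [h, Matrix.mulVec_mulVec, precision_mul_postCov, Matrix.one_mulVec]

/-- The law of the state and of the noises of the sources `k 0, k 1, …`. -/
noncomputable abbrev pathLaw {n : ℕ} (k : Fin n → Fin K) :=
  stateNoiseLaw E.priorMean E.priorCov fun i => E.noiseVar (k i)

section

variable {n : ℕ} (k : Fin n → Fin K)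

/-- State coefficients of the estimation error after `t` observations. -/
noncomputable def errState {t : ℕ} (h : t ≤ n) : Fin K → ℝ :=
  E.priorCov⁻¹ *ᵥ E.postCov (pathCounts h k) 0

/-- Noise coefficients of the estimation error after `t` observations. -/
noncomputable def errNoise {t : ℕ} (h : t ≤ n) (i : Fin n) : ℝ :=
  if (i : ℕ) < t then -((E.postCov (pathCounts h k) 0 ⬝ᵥ E.C (k i)) / E.noiseVar (k i)) else 0

/-- Row 0 of the posterior covariance, p, solves (precision) p = e₀. Splitting the precision into
the prior part and one term per observation isolates the prior part. -/
theorem errState_eq {t : ℕ} (h : t ≤ n) (j : Fin K) :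
    E.errState k h j = (Pi.single 0 1 : Fin K → ℝ) j +
      ∑ i, E.errNoise k h i * E.C (k i) j := by
  have h1 := congrFun (E.precision_counts_mulVec (fun i : Fin t => (k (i.castLE h), (0 : ℝ)))
    (E.postCov (pathCounts h k) 0)) j
  have h2 := congrFun (E.precision_mulVec_postCov_zero (pathCounts h k)) j
  rw [pathCounts] at h2
  rw [pathCounts] at h1
  rw [h1] at h2
  simp only [Pi.add_apply, Finset.sum_apply, Pi.smul_apply, smul_eq_mul] at h2
  have h3 := Fin.sum_univ_castLE h (fun i : Fin n =>
    (E.postCov (pathCounts h k) 0 ⬝ᵥ E.C (k i)) / E.noiseVar (k i) * E.C (k i) j)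
  simp only [pathCounts] at h3
  rw [h3] at h2
  simp only [errState, errNoise, pathCounts]
  rw [← h2, add_assoc, ← Finset.sum_add_distrib]
  simp only [left_eq_add]
  refine Finset.sum_eq_zero fun i _ => ?_
  split_ifs <;> simp

/-- By `errState_eq` the state part of the functional is θ₁ plus noiseless observations weighted by
the noise coefficients. The noise part completes these to the actual observations, whose weights are
minus those in the posterior mean. -/
theorem linFun_err {t : ℕ} (h : t ≤ n) (ω) :
    linFun (E.errState k h) (E.errNoise k h) ω - ∑ j, E.errState k h j * E.priorMean j =
      ω.1 0 - E.postMean ((E.pathData k ω).take h) := by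
  rw [postMean_eq, counts_take_pathData]
  have h3 := Fin.sum_univ_castLE h (fun i : Fin n => (E.pathData k ω i).2 *
    ((E.postCov (pathCounts h k) 0 ⬝ᵥ E.C (k i)) / E.noiseVar (k i)))
  have h4 : ∑ i : Fin t, ((E.pathData k ω).take h i).2 * ((E.postCov (pathCounts h k) 0 ⬝ᵥ
      E.C ((E.pathData k ω).take h i).1) / E.noiseVar ((E.pathData k ω).take h i).1) =
      -∑ i, (∑ j, E.C (k i) j * ω.1 j + ω.2 i) * E.errNoise k h i := by
    refine h3.trans ?_
    rw [← Finset.sum_neg_distrib]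
    refine Finset.sum_congr rfl fun i _ => ?_
    simp only [errNoise, pathData]
    split_ifs <;> ring
  have h5 : E.postCov (pathCounts h k) 0 ⬝ᵥ E.priorCov⁻¹ *ᵥ (fun i => E.priorMean i) =
      ∑ j, E.errState k h j * E.priorMean j := by
    rw [Matrix.dotProduct_mulVec, ← Matrix.mulVec_transpose, priorCov_inv_transpose]; rfl
  rw [h4, h5, linFun]
  have h6 : ∑ j, E.errState k h j * ω.1 j = ω.1 0 +
      ∑ i, (∑ j, E.C (k i) j * ω.1 j) * E.errNoise k h i := by
    simp only [errState_eq, add_mul, Finset.sum_add_distrib, Finset.sum_mul]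
    rw [Finset.sum_comm]
    congr 1
    · simp [Pi.single_apply]
    · exact Finset.sum_congr rfl fun i _ => Finset.sum_congr rfl fun j _ => by ring
  rw [h6]
  simp only [add_mul, Finset.sum_add_distrib, mul_comm (ω.2 _)]
  ring

/-- The coefficients of the error contain the inverse prior covariance and the inverse noise
variances, and these cancel against the covariance of state and noises. -/
theorem covariance_err {t : ℕ} (h : t ≤ n) (a : Fin K → ℝ) (b : Fin n → ℝ) :
    cov[linFun (E.errState k h) (E.errNoise k h), linFun a b; E.pathLaw k] =
      E.postCov (pathCounts h k) 0 ⬝ᵥ a -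
        ∑ i : Fin n, if (i : ℕ) < t then (E.postCov (pathCounts h k) 0 ⬝ᵥ E.C (k i)) * b i else 0 := by
  rw [covariance_linFun _ _ E.priorCov_posDef.posSemidef, sub_eq_add_neg, ← Finset.sum_neg_distrib]
  congr 1
  · rw [errState, Matrix.dotProduct_mulVec, ← Matrix.mulVec_transpose, priorCov_transpose,
      Matrix.mulVec_mulVec, priorCov_mul_inv, Matrix.one_mulVec]
  · refine Finset.sum_congr rfl fun i _ => ?_
    have := E.noiseVar_pos (k i)
    simp only [errNoise]
    split_ifs
    · field_simp
    · simp

theorem covariance_err_obs {t : ℕ} (h : t ≤ n) (i : Fin n) (hi : (i : ℕ) < t) :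
    cov[linFun (E.errState k h) (E.errNoise k h), linFun (E.C (k i)) (Pi.single i 1);
      E.pathLaw k] = 0 := by
  rw [covariance_err, Finset.sum_eq_single i]
  · simp [hi]
  · intro j _ hj; simp [hj]
  · simp

/-- The error at `s` is θ₁ plus a combination of the first `s` observations, up to a constant. The
later error is orthogonal to these, so only its covariance with θ₁ remains. Hence increments of the
posterior mean have variance equal to the drop in `f`. -/
theorem covariance_err_err {s t : ℕ} (hs : s ≤ n) (ht : t ≤ n) (hst : s ≤ t) :
    cov[linFun (E.errState k hs) (E.errNoise k hs), linFun (E.errState k ht) (E.errNoise k ht);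
      E.pathLaw k] = E.f (pathCounts ht k) := by
  rw [covariance_comm, covariance_err, f]
  have h1 : E.postCov (pathCounts ht k) 0 ⬝ᵥ E.errState k hs = E.postCov (pathCounts ht k) 0 0 +
      ∑ i, E.errNoise k hs i * (E.postCov (pathCounts ht k) 0 ⬝ᵥ E.C (k i)) := by
    have h2 : E.errState k hs = Pi.single 0 1 + ∑ i, E.errNoise k hs i • E.C (k i) := by
      funext j; simp [errState_eq]
    rw [h2, dotProduct_add, dotProduct_sum]
    simp [dotProduct_smul]
  rw [h1, add_sub_assoc, ← Finset.sum_sub_distrib, Finset.sum_eq_zero, add_zero]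
  intro i _
  simp only [errNoise]
  split_ifs <;> first | omega | ring

end

/-- Given the first `t` observations along a fixed sequence of sources, the next posterior mean
is normal around the current one. -/
theorem lintegral_pathData_postMean {t : ℕ} (k : Fin (t + 1) → Fin K)
    {φ : Data K t × ℝ → ℝ≥0∞} (hφ : Measurable φ) :
    ∫⁻ ω, φ ((E.pathData k ω).take t.le_succ, E.postMean (E.pathData k ω)) ∂(E.pathLaw k) =
      ∫⁻ ω, ∫⁻ z, φ ((E.pathData k ω).take t.le_succ,
        E.postMean ((E.pathData k ω).take t.le_succ) +
          √(E.f (counts ((E.pathData k ω).take t.le_succ)) - E.f (counts (E.pathData k ω))) * z)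
        ∂(gaussianReal 0 1) ∂(E.pathLaw k) := by
  set a := E.errState k t.le_succ
  set b := E.errNoise k t.le_succ
  set a' := E.errState k le_rfl
  set b' := E.errNoise k le_rfl
  have hlin : linFun (a - a') (b - b') = linFun a b - linFun a' b' := by
    funext ω
    simp only [linFun, Pi.sub_apply, sub_mul, Finset.sum_sub_distrib]; ring
  have hmem : ∀ a b, MemLp (linFun a b) 2 (E.pathLaw k) := fun a b =>
    (hasGaussianLaw_linFun _ _ _ a b).memLp_two
  -- The increment of the posterior mean is the error at `t` minus the error at `t + 1`, up to a
  -- constant; both are orthogonal to the first `t` observations.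
  have hcov : ∀ i : Fin t, cov[linFun (E.C (k (i.castLE t.le_succ)))
      (Pi.single (i.castLE t.le_succ) 1), linFun (a - a') (b - b'); E.pathLaw k] = 0 := by
    intro i
    rw [hlin, covariance_sub_right (hmem _ _) (hmem _ _) (hmem _ _), covariance_comm,
      covariance_comm _ (linFun a' b'), covariance_err_obs _ _ _ _ (by simp),
      covariance_err_obs _ _ _ _ (by simp), sub_zero]
  have hvar : cov[linFun (a - a') (b - b'), linFun (a - a') (b - b'); E.pathLaw k] =
      E.f (pathCounts t.le_succ k) - E.f (pathCounts le_rfl k) := by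
    rw [hlin, covariance_sub_sub (hmem _ _) (hmem _ _) (hmem _ _) (hmem _ _),
      covariance_err_err _ _ _ _ le_rfl, covariance_err_err _ _ _ _ le_rfl,
      covariance_err_err _ _ _ _ t.le_succ, covariance_comm, covariance_err_err _ _ _ _ t.le_succ]
    ring
  have key := lintegral_linFun_regression E.priorMean (V := E.priorCov)
    (fun i => E.noiseVar (k i)) (fun i : Fin t => E.C (k (i.castLE t.le_succ)))
    (fun i => Pi.single (i.castLE t.le_succ) 1) (a - a') (b - b') hcov
    (fun y i => ((k (i.castLE t.le_succ), y i) : Fin K × ℝ)) (by fun_prop)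
    (φ := fun p => φ (p.1, E.postMean p.1 + p.2)) (by fun_prop)
  have htake : ∀ ω, (fun i : Fin t => ((k (i.castLE t.le_succ),
      linFun (E.C (k (i.castLE t.le_succ))) (Pi.single (i.castLE t.le_succ) 1) ω) : Fin K × ℝ)) =
      (E.pathData k ω).take t.le_succ := by
    intro ω; funext i; simp [linFun, Data.take, pathData, Pi.single_apply]
  simp only [htake, hvar] at key
  refine Eq.trans ?_ key
  refine lintegral_congr fun ω => ?_
  congr 2
  have e1 := E.linFun_err k t.le_succ ω
  have e2 := E.linFun_err k le_rfl ω
  have e3 : (E.pathData k ω).take le_rfl = E.pathData k ω := rfl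
  rw [e3] at e2
  have e4 : linFun (a - a') (b - b') ω - ∑ j, (a - a') j * E.priorMean j =
      (linFun a b ω - ∑ j, a j * E.priorMean j) - (linFun a' b' ω - ∑ j, a' j * E.priorMean j) := by
    rw [hlin]
    simp only [Pi.sub_apply, sub_mul, Finset.sum_sub_distrib]; ring
  rw [e4, e1, e2]; ring

/-- Given the observations along a fixed sequence of sources, the state is normal around its
posterior mean. -/
theorem lintegral_pathData_state {t : ℕ} (k : Fin t → Fin K)
    {φ : Data K t × ℝ → ℝ≥0∞} (hφ : Measurable φ) :
    ∫⁻ ω, φ (E.pathData k ω, ω.1 0) ∂(E.pathLaw k) =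
      ∫⁻ ω, ∫⁻ z, φ (E.pathData k ω, E.postMean (E.pathData k ω) +
          √(E.f (counts (E.pathData k ω))) * z) ∂(gaussianReal 0 1) ∂(E.pathLaw k) := by
  have key := lintegral_linFun_regression E.priorMean (V := E.priorCov)
    (fun i => E.noiseVar (k i)) (fun i : Fin t => E.C (k i))
    (fun i => Pi.single i 1) (E.errState k le_rfl) (E.errNoise k le_rfl)
    (fun i => by rw [covariance_comm]; exact E.covariance_err_obs k le_rfl i i.isLt)
    (fun y i => ((k i, y i) : Fin K × ℝ)) (by fun_prop)
    (φ := fun p => φ (p.1, E.postMean p.1 + p.2)) (by fun_prop)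
  have htake : ∀ ω, (fun i : Fin t => ((k i,
      linFun (E.C (k i)) (Pi.single i 1) ω) : Fin K × ℝ)) = E.pathData k ω := by
    intro ω; funext i; simp [linFun, pathData, Pi.single_apply]
  simp only [htake, E.covariance_err_err k le_rfl le_rfl le_rfl, linFun_err] at key
  refine Eq.trans ?_ key
  refine lintegral_congr fun ω => ?_
  congr 2
  have e3 : (E.pathData k ω).take le_rfl = E.pathData k ω := rfl
  rw [e3]; ring

end Environment

end DynamicInfo

/-! ### Beliefs generated by an information acquisition strategy -/

namespace DynamicInfo

theorem counts_snoc {K t : ℕ} (x : Data K t) (y : Fin K × ℝ) :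
    counts (Fin.snoc (α := fun _ => Fin K × ℝ) x y : Data K (t + 1)) =
      counts x + Pi.single y.1 1 := by
  funext k
  simp only [counts, Finset.card_filter, Fin.sum_univ_castSucc, Fin.snoc_castSucc, Fin.snoc_last,
    Pi.add_apply, Pi.single_apply, eq_comm]

theorem Environment.beliefs_snoc {K t : ℕ} [NeZero K] (E : Environment K) (x : Data K t)
    (y : Fin K × ℝ) :
    E.beliefs (Fin.snoc (α := fun _ => Fin K × ℝ) x y : Data K (t + 1)) =
      (Fin.snoc (α := fun _ => ℝ × Division K) (E.beliefs x)
        (E.postMean (Fin.snoc (α := fun _ => Fin K × ℝ) x y : Data K (t + 1)),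
          counts x + Pi.single y.1 1) : Hist K (t + 1)) := by
  funext s
  refine Fin.lastCases ?_ (fun s => ?_) s
  · rw [Fin.snoc_last, ← counts_snoc]
    rfl
  · rw [Fin.snoc_castSucc]
    have h : ∀ i : Fin s, (Fin.snoc (α := fun _ => Fin K × ℝ) x y : Data K (t + 1))
        (i.castLE (Nat.lt_succ_iff.mp s.castSucc.isLt)) =
        x (i.castLE (Nat.lt_succ_iff.mp s.isLt)) := by
      intro i
      exact Fin.snoc_castSucc (α := fun _ => Fin K × ℝ) y x (i.castLE (Nat.lt_succ_iff.mp s.isLt))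
    simp only [Environment.beliefs]
    exact congrArg (fun p : Data K s => (E.postMean p, counts p)) (funext h)

namespace InfoStrategy

variable {K : ℕ} (S : InfoStrategy K)

/-- The division vector after the observation that `S` prescribes in period `t + 1`. -/
def nextDiv (t : ℕ) (p : S.Seed × Hist K t) : Division K :=
  (p.2 (Fin.last t)).2 + Pi.single (S.choose t p) 1

@[fun_prop]
theorem measurable_nextDiv (t : ℕ) : Measurable (S.nextDiv t) := by
  have h : S.nextDiv t = (fun q : Division K × Fin K => q.1 + Pi.single q.2 1) ∘
      fun p => ((p.2 (Fin.last t)).2, S.choose t p) := rfl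
  rw [h]
  exact (measurable_of_countable _).comp ((by fun_prop : Measurable
    fun p : S.Seed × Hist K t => (p.2 (Fin.last t)).2).prodMk (S.measurable_choose t))

variable [NeZero K] (E : Environment K)

instance : IsProbabilityMeasure (S.prob E) := by unfold prob; infer_instance

instance (T : ℕ) : IsProbabilityMeasure (S.law E T) :=
  Measure.isProbabilityMeasure_map (S.measurable_hist E T).aemeasurable

theorem take_data (t : ℕ) (ω : S.Sample) :
    (S.data E ω (t + 1)).take t.le_succ = S.data E ω t := by
  funext i
  exact Fin.snoc_castSucc (α := fun _ => Fin K × ℝ) _ _ i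

theorem counts_data_succ (t : ℕ) (ω : S.Sample) :
    counts (S.data E ω (t + 1)) = S.nextDiv t (ω.2.2, S.hist E t ω) :=
  counts_snoc _ _

theorem hist_succ (t : ℕ) (ω : S.Sample) :
    S.hist E (t + 1) ω = (Fin.snoc (α := fun _ => ℝ × Division K) (S.hist E t ω)
      (E.postMean (S.data E ω (t + 1)), S.nextDiv t (ω.2.2, S.hist E t ω)) : Hist K (t + 1)) :=
  E.beliefs_snoc _ _

theorem init_hist (t : ℕ) (ω : S.Sample) : (S.hist E (t + 1) ω).init = S.hist E t ω := by
  rw [hist_succ]; funext s; exact Fin.snoc_castSucc (α := fun _ => ℝ × Division K) _ _ s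

theorem hist_last (t : ℕ) (ω : S.Sample) : S.hist E t ω (Fin.last t) =
    (E.postMean (S.data E ω t), counts (S.data E ω t)) := rfl

/-- The sources in the data are the ones that `S` prescribes when the seed is `s`. -/
def Follows {n t : ℕ} (k : Fin n → Fin K) (h : n ≤ t + 1) (s : S.Seed) (x : Data K t) : Prop :=
  ∀ i : Fin n, S.choose i (s, E.beliefs (x.take (by omega : (i : ℕ) ≤ t))) = k i

theorem measurableSet_follows {n t : ℕ} (k : Fin n → Fin K) (h : n ≤ t + 1) (s : S.Seed) :
    MeasurableSet {x : Data K t | S.Follows E k h s x} := by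
  simp only [Follows, Set.ofPred_forall]
  refine MeasurableSet.iInter fun i => ?_
  exact ((S.measurable_choose i).comp (measurable_const.prodMk
    (E.measurable_beliefs.comp (Data.measurable_take _)))) (measurableSet_singleton (k i))

theorem data_eq_pathData (ω : S.Sample) {n : ℕ} (k : Fin n → Fin K)
    (hk : ∀ i, (S.data E ω n i).1 = k i) :
    S.data E ω n = E.pathData k (ω.1, fun i => ω.2.1 i (k i)) := by
  induction n with
  | zero => funext i; exact i.elim0
  | succ n ih =>
    funext i
    refine Fin.lastCases ?_ (fun i => ?_) i
    · have h := hk (Fin.last n)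
      simp only [data, Fin.snoc_last] at h ⊢
      rw [h]
      rfl
    · have h := ih (fun i => k i.castSucc) (fun i => by
        have := hk i.castSucc
        simpa only [data, Fin.snoc_castSucc] using this)
      simp only [data, Fin.snoc_castSucc]
      rw [h]
      rfl

/-- As long as the data agree with the path, the next choice is the next source on the path. Since
`n ≤ t + 1`, all `n` choices are settled by the first `t` observations, so following `k` is an event
in the past of the observation numbered `t + 1`. -/
theorem data_eq_pathData_of_follows (ω : S.Sample) {n t : ℕ} (k : Fin n → Fin K) (htn : t ≤ n)
    (hn : n ≤ t + 1)
    (hk : S.Follows E k hn ω.2.2 ((E.pathData k (ω.1, fun i => ω.2.1 i (k i))).take htn)) :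
    ∀ m (hm : m ≤ n), S.data E ω m = (E.pathData k (ω.1, fun i => ω.2.1 i (k i))).take hm := by
  intro m
  induction m with
  | zero => intro _; funext i; exact i.elim0
  | succ m ih =>
    intro hm
    have ihm := ih (by omega)
    have h1 : S.choose m (ω.2.2, E.beliefs (S.data E ω m)) = k ⟨m, hm⟩ := by
      rw [ihm]; exact hk ⟨m, hm⟩
    funext i
    refine Fin.lastCases ?_ (fun i => ?_) i
    · simp only [data, Fin.snoc_last]
      rw [h1]
      rfl
    · simp only [data, Fin.snoc_castSucc]
      rw [ihm]
      rfl

theorem take_data_of_le (ω : S.Sample) {m n : ℕ} (h : m ≤ n) :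
    (S.data E ω n).take h = S.data E ω m := by
  induction n, h using Nat.le_induction with
  | base => rfl
  | succ n hmn ih =>
    rw [← ih, ← S.take_data E n ω]; rfl

theorem follows_data (ω : S.Sample) {n t : ℕ} (hn : n ≤ t + 1) :
    S.Follows E (fun i => (S.data E ω n i).1) hn ω.2.2 (S.data E ω t) := by
  intro i
  rw [take_data_of_le]
  have h := congrFun (take_data_of_le S E ω (show (i : ℕ) + 1 ≤ n from i.isLt)) (Fin.last i)
  have h2 : (S.data E ω n).take (show (i : ℕ) + 1 ≤ n from i.isLt) (Fin.last i) =
    S.data E ω n i := rfl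
  rw [h2] at h
  change _ = (S.data E ω n i).1
  rw [h]
  simp only [data, Fin.snoc_last]

open Classical in
/-- The data of an adaptive strategy, as a sum over the sequences of sources it may choose. -/
theorem eval_data_eq_sum {n t : ℕ} (htn : t ≤ n) (hn : n ≤ t + 1) (ω : S.Sample)
    (F : Data K n → ℝ≥0∞) :
    F (S.data E ω n) = ∑ k : Fin n → Fin K,
      if S.Follows E k hn ω.2.2 ((E.pathData k (ω.1, fun i => ω.2.1 i (k i))).take htn) then
        F (E.pathData k (ω.1, fun i => ω.2.1 i (k i))) else 0 := by
  have h0 := S.data_eq_pathData E ω (fun i => (S.data E ω n i).1) fun _ => rfl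
  rw [Finset.sum_eq_single fun i => (S.data E ω n i).1]
  · rw [← h0, if_pos]
    rw [take_data_of_le]
    exact S.follows_data E ω hn
  · intro k _ hk
    refine if_neg fun hf => hk ?_
    have h1 := S.data_eq_pathData_of_follows E ω k htn hn hf n le_rfl
    funext i
    rw [h1]; rfl
  · simp

end InfoStrategy

/-- Extracting the noises of a sequence of sources. -/
theorem Environment.measurePreserving_path {K n : ℕ} (E : Environment K) (k : Fin n → Fin K) :
    MeasurePreserving (fun p : EuclideanSpace ℝ (Fin K) × (ℕ → Fin K → ℝ) =>
        (p.1, fun i : Fin n => p.2 i (k i)))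
      ((multivariateGaussian E.priorMean E.priorCov).prod
        (Measure.infinitePi fun _ : ℕ => Measure.pi fun k : Fin K => gaussianReal 0 (E.noiseVar k)))
      (stateNoiseLaw E.priorMean E.priorCov fun i => E.noiseVar (k i)) := by
  have hN : MeasurePreserving (fun (ε : ℕ → Fin K → ℝ) (i : Fin n) => ε i (k i))
      (Measure.infinitePi fun _ : ℕ => Measure.pi fun k : Fin K => gaussianReal 0 (E.noiseVar k))
      (Measure.pi fun i => gaussianReal 0 (E.noiseVar (k i))) := by
    refine ⟨by fun_prop, ?_⟩
    let P : ℕ → Measure (Fin K → ℝ) :=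
      fun _ => Measure.pi fun k : Fin K => gaussianReal 0 (E.noiseVar k)
    have h1 : iIndepFun (fun (i : ℕ) (ε : ℕ → Fin K → ℝ) => ε i) (Measure.infinitePi P) :=
      iIndepFun_infinitePi (X := fun _ x => x) fun i => measurable_id
    -- Entries of the path lie in distinct periods, so their noises are independent even when a
    -- source recurs.
    have h2 : iIndepFun (fun (i : Fin n) (ε : ℕ → Fin K → ℝ) => ε i (k i))
        (Measure.infinitePi P) :=
      (h1.precomp Fin.val_injective).comp (fun (i : Fin n) (x : Fin K → ℝ) => x (k i))
        fun i => measurable_pi_apply _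
    have hm : ∀ i : Fin n, Measurable fun ε : ℕ → Fin K → ℝ => ε i (k i) := fun i => by fun_prop
    rw [iIndepFun_iff_map_fun_eq_pi_map fun i => (hm i).aemeasurable] at h2
    rw [h2]
    congr 1
    funext i
    have h3 : MeasurePreserving (fun ε : ℕ → Fin K → ℝ => ε i (k i)) (Measure.infinitePi P)
        (gaussianReal 0 (E.noiseVar (k i))) :=
      (measurePreserving_eval (fun k : Fin K => gaussianReal 0 (E.noiseVar k)) (k i)).comp
        (measurePreserving_eval_infinitePi P i)
    exact h3.map_eq
  exact (MeasurePreserving.id _).prod hN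

/-! ### Conditional laws of the next mean and of the state under an adaptive strategy -/

namespace InfoStrategy

variable {K : ℕ} (S : InfoStrategy K) (E : Environment K)

/-- With the seed integrated last, the strategy can be treated as a deterministic function of
beliefs. -/
theorem lintegral_prob {F : S.Sample → ℝ≥0∞} (hF : Measurable F) :
    ∫⁻ ω, F ω ∂(S.prob E) = ∫⁻ s, ∫⁻ p : EuclideanSpace ℝ (Fin K) × (ℕ → Fin K → ℝ),
      F (p.1, p.2, s) ∂((multivariateGaussian E.priorMean E.priorCov).prod
        (Measure.infinitePi fun _ : ℕ => Measure.pi fun k : Fin K =>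
          gaussianReal 0 (E.noiseVar k))) ∂S.seedLaw := by
  rw [prob, ← Measure.prodAssoc_prod, lintegral_map hF (MeasurableEquiv.measurable _)]
  exact lintegral_prod_symm _ (hF.comp (MeasurableEquiv.measurable _)).aemeasurable

variable [NeZero K]

-- For a fixed seed, the sample space splits according to the sequence of sources chosen. Whether a
-- sequence is followed depends only on the first `t` observations, so the indicator is absorbed
-- into the test function and the fixed-path statement `lintegral_pathData_postMean` applies to each
-- piece.
open Classical in
theorem lintegral_next_mean_seed (t : ℕ) (s : S.Seed)
    {φ : Hist K t × ℝ → ℝ≥0∞} (hφ : Measurable φ) :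
    ∫⁻ p : EuclideanSpace ℝ (Fin K) × (ℕ → Fin K → ℝ),
        φ (S.hist E t (p.1, p.2, s), E.postMean (S.data E (p.1, p.2, s) (t + 1)))
        ∂((multivariateGaussian E.priorMean E.priorCov).prod
          (Measure.infinitePi fun _ : ℕ => Measure.pi fun k : Fin K =>
            gaussianReal 0 (E.noiseVar k))) =
      ∫⁻ p : EuclideanSpace ℝ (Fin K) × (ℕ → Fin K → ℝ), ∫⁻ z,
        φ (S.hist E t (p.1, p.2, s), (S.hist E t (p.1, p.2, s) (Fin.last t)).1 +
          √(E.f (S.hist E t (p.1, p.2, s) (Fin.last t)).2 -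
            E.f (S.nextDiv t (s, S.hist E t (p.1, p.2, s)))) * z) ∂(gaussianReal 0 1)
        ∂((multivariateGaussian E.priorMean E.priorCov).prod
          (Measure.infinitePi fun _ : ℕ => Measure.pi fun k : Fin K =>
            gaussianReal 0 (E.noiseVar k))) := by
  have hf : Measurable E.f := measurable_of_countable _
  let F1 : Data K (t + 1) → ℝ≥0∞ := fun y => φ (E.beliefs (y.take t.le_succ), E.postMean y)
  let F2 : Data K (t + 1) → ℝ≥0∞ := fun y => ∫⁻ z, φ (E.beliefs (y.take t.le_succ),
    E.postMean (y.take t.le_succ) + √(E.f (counts (y.take t.le_succ)) - E.f (counts y)) * z)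
      ∂(gaussianReal 0 1)
  have hF1 : Measurable F1 := by fun_prop
  have hF2 : Measurable F2 := by
    refine Measurable.lintegral_prod_right' (f := fun p : Data K (t + 1) × ℝ =>
      φ (E.beliefs (p.1.take t.le_succ), E.postMean (p.1.take t.le_succ) +
        √(E.f (counts (p.1.take t.le_succ)) - E.f (counts p.1)) * p.2)) ?_
    fun_prop
  have h1 : ∀ p : EuclideanSpace ℝ (Fin K) × (ℕ → Fin K → ℝ),
      φ (S.hist E t (p.1, p.2, s), E.postMean (S.data E (p.1, p.2, s) (t + 1))) =
        F1 (S.data E (p.1, p.2, s) (t + 1)) := by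
    intro p
    simp only [F1, take_data]; rfl
  have h2 : ∀ p : EuclideanSpace ℝ (Fin K) × (ℕ → Fin K → ℝ), ∫⁻ z,
        φ (S.hist E t (p.1, p.2, s), (S.hist E t (p.1, p.2, s) (Fin.last t)).1 +
          √(E.f (S.hist E t (p.1, p.2, s) (Fin.last t)).2 -
            E.f (S.nextDiv t (s, S.hist E t (p.1, p.2, s)))) * z) ∂(gaussianReal 0 1) =
        F2 (S.data E (p.1, p.2, s) (t + 1)) := by
    intro p
    simp only [F2, take_data, counts_data_succ, hist_last]; rfl
  simp only [h1, h2]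
  simp only [S.eval_data_eq_sum E t.le_succ le_rfl]
  have hmeas : ∀ (k : Fin (t + 1) → Fin K) (F : Data K (t + 1) → ℝ≥0∞), Measurable F →
      Measurable fun q : EuclideanSpace ℝ (Fin K) × (Fin (t + 1) → ℝ) =>
        if S.Follows E k le_rfl s ((E.pathData k q).take t.le_succ) then
          F (E.pathData k q) else 0 := by
    intro k F hF
    refine Measurable.ite ?_ (by fun_prop) measurable_const
    exact (by fun_prop : Measurable fun q => (E.pathData k q).take t.le_succ)
      (S.measurableSet_follows E k le_rfl s)
  have hpath := fun k : Fin (t + 1) → Fin K => (E.measurePreserving_path k)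
  refine (lintegral_finsetSum _ fun k _ => (hmeas k F1 hF1).comp (hpath k).measurable).trans
    (Eq.trans ?_ (lintegral_finsetSum _ fun k _ =>
      (hmeas k F2 hF2).comp (hpath k).measurable).symm)
  refine Finset.sum_congr rfl fun k _ => ?_
  have e1 := (hpath k).lintegral_comp (hmeas k F1 hF1)
  have e2 := (hpath k).lintegral_comp (hmeas k F2 hF2)
  refine e1.trans (Eq.trans ?_ e2.symm)
  have hψ : Measurable fun q : Data K t × ℝ =>
      if S.Follows E k le_rfl s q.1 then φ (E.beliefs q.1, q.2) else 0 := by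
    refine Measurable.ite ?_ (by fun_prop) measurable_const
    exact measurable_fst (S.measurableSet_follows E k le_rfl s)
  refine (E.lintegral_pathData_postMean k hψ).trans (lintegral_congr fun q => ?_)
  split_ifs
  · rfl
  · simp

-- The same splitting over source sequences, now of length `t`, reduces this to
-- `lintegral_pathData_state`.
open Classical in
theorem lintegral_state_seed (t : ℕ) (s : S.Seed) {φ : Hist K t × ℝ → ℝ≥0∞} (hφ : Measurable φ) :
    ∫⁻ p : EuclideanSpace ℝ (Fin K) × (ℕ → Fin K → ℝ), φ (S.hist E t (p.1, p.2, s), p.1 0)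
        ∂((multivariateGaussian E.priorMean E.priorCov).prod
          (Measure.infinitePi fun _ : ℕ => Measure.pi fun k : Fin K =>
            gaussianReal 0 (E.noiseVar k))) =
      ∫⁻ p : EuclideanSpace ℝ (Fin K) × (ℕ → Fin K → ℝ), ∫⁻ z,
        φ (S.hist E t (p.1, p.2, s), (S.hist E t (p.1, p.2, s) (Fin.last t)).1 +
          √(E.f (S.hist E t (p.1, p.2, s) (Fin.last t)).2) * z) ∂(gaussianReal 0 1)
        ∂((multivariateGaussian E.priorMean E.priorCov).prod
          (Measure.infinitePi fun _ : ℕ => Measure.pi fun k : Fin K =>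
            gaussianReal 0 (E.noiseVar k))) := by
  have hf : Measurable E.f := measurable_of_countable _
  let F1 : ℝ → Data K t → ℝ≥0∞ := fun θ y => φ (E.beliefs y, θ)
  let F2 : Data K t → ℝ≥0∞ := fun y => ∫⁻ z, φ (E.beliefs y,
    E.postMean y + √(E.f (counts y)) * z) ∂(gaussianReal 0 1)
  have hF2 : Measurable F2 := by
    refine Measurable.lintegral_prod_right' (f := fun p : Data K t × ℝ =>
      φ (E.beliefs p.1, E.postMean p.1 + √(E.f (counts p.1)) * p.2)) ?_
    fun_prop
  have h1 : ∀ p : EuclideanSpace ℝ (Fin K) × (ℕ → Fin K → ℝ),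
      φ (S.hist E t (p.1, p.2, s), p.1 0) = F1 (p.1 0) (S.data E (p.1, p.2, s) t) := fun p => rfl
  have h2 : ∀ p : EuclideanSpace ℝ (Fin K) × (ℕ → Fin K → ℝ), ∫⁻ z,
        φ (S.hist E t (p.1, p.2, s), (S.hist E t (p.1, p.2, s) (Fin.last t)).1 +
          √(E.f (S.hist E t (p.1, p.2, s) (Fin.last t)).2) * z) ∂(gaussianReal 0 1) =
        F2 (S.data E (p.1, p.2, s) t) := fun p => rfl
  simp only [h1, h2]
  simp only [S.eval_data_eq_sum E le_rfl (Nat.le_succ t)]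
  have hset : ∀ k : Fin t → Fin K, MeasurableSet {q : EuclideanSpace ℝ (Fin K) × (Fin t → ℝ) |
      S.Follows E k t.le_succ s ((E.pathData k q).take le_rfl)} := fun k =>
    (by fun_prop : Measurable fun q => (E.pathData k q).take le_rfl)
      (S.measurableSet_follows E k t.le_succ s)
  have hm1 : ∀ k : Fin t → Fin K, Measurable fun q : EuclideanSpace ℝ (Fin K) × (Fin t → ℝ) =>
      if S.Follows E k t.le_succ s ((E.pathData k q).take le_rfl) then
        F1 (q.1 0) (E.pathData k q) else 0 := fun k =>
    Measurable.ite (hset k) (by fun_prop) measurable_const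
  have hm2 : ∀ k : Fin t → Fin K, Measurable fun q : EuclideanSpace ℝ (Fin K) × (Fin t → ℝ) =>
      if S.Follows E k t.le_succ s ((E.pathData k q).take le_rfl) then
        F2 (E.pathData k q) else 0 := fun k =>
    Measurable.ite (hset k) (by fun_prop) measurable_const
  have hpath := fun k : Fin t → Fin K => (E.measurePreserving_path k)
  refine (lintegral_finsetSum _ fun k _ => (hm1 k).comp (hpath k).measurable).trans
    (Eq.trans ?_ (lintegral_finsetSum _ fun k _ => (hm2 k).comp (hpath k).measurable).symm)
  refine Finset.sum_congr rfl fun k _ => ?_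
  refine ((hpath k).lintegral_comp (hm1 k)).trans
    (Eq.trans ?_ ((hpath k).lintegral_comp (hm2 k)).symm)
  have hψ : Measurable fun q : Data K t × ℝ =>
      if S.Follows E k t.le_succ s q.1 then φ (E.beliefs q.1, q.2) else 0 := by
    refine Measurable.ite ?_ (by fun_prop) measurable_const
    exact measurable_fst (S.measurableSet_follows E k t.le_succ s)
  refine (E.lintegral_pathData_state k hψ).trans (lintegral_congr fun q => ?_)
  change _ = if S.Follows E k t.le_succ s (E.pathData k q) then F2 (E.pathData k q) else 0
  split_ifs
  · rfl
  · simp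

/-- Given the seed and the history, the next posterior mean is normal around the current one. -/
theorem lintegral_next_mean (t : ℕ) {φ : S.Seed × Hist K t × ℝ → ℝ≥0∞} (hφ : Measurable φ) :
    ∫⁻ ω, φ (ω.2.2, S.hist E t ω, E.postMean (S.data E ω (t + 1))) ∂(S.prob E) =
      ∫⁻ ω, ∫⁻ z, φ (ω.2.2, S.hist E t ω, (S.hist E t ω (Fin.last t)).1 +
        √(E.f (S.hist E t ω (Fin.last t)).2 - E.f (S.nextDiv t (ω.2.2, S.hist E t ω))) * z)
        ∂(gaussianReal 0 1) ∂(S.prob E) := by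
  have hf : Measurable E.f := measurable_of_countable _
  rw [lintegral_prob _ _ (by fun_prop), lintegral_prob]
  · exact lintegral_congr fun s =>
      S.lintegral_next_mean_seed E t s (φ := fun q => φ (s, q.1, q.2)) (by fun_prop)
  · refine Measurable.lintegral_prod_right' (f := fun p : S.Sample × ℝ =>
      φ (p.1.2.2, S.hist E t p.1, (S.hist E t p.1 (Fin.last t)).1 +
        √(E.f (S.hist E t p.1 (Fin.last t)).2 -
          E.f (S.nextDiv t (p.1.2.2, S.hist E t p.1))) * p.2)) ?_
    fun_prop

/-- Given the seed and the history, the payoff-relevant state is normal around its posterior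
mean. -/
theorem lintegral_state (t : ℕ) {φ : S.Seed × Hist K t × ℝ → ℝ≥0∞} (hφ : Measurable φ) :
    ∫⁻ ω, φ (ω.2.2, S.hist E t ω, ω.1 0) ∂(S.prob E) =
      ∫⁻ ω, ∫⁻ z, φ (ω.2.2, S.hist E t ω, (S.hist E t ω (Fin.last t)).1 +
        √(E.f (S.hist E t ω (Fin.last t)).2) * z) ∂(gaussianReal 0 1) ∂(S.prob E) := by
  have hf : Measurable E.f := measurable_of_countable _
  rw [lintegral_prob _ _ (by fun_prop), lintegral_prob]
  · exact lintegral_congr fun s =>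
      S.lintegral_state_seed E t s (φ := fun q => φ (s, q.1, q.2)) (by fun_prop)
  · refine Measurable.lintegral_prod_right' (f := fun p : S.Sample × ℝ =>
      φ (p.1.2.2, S.hist E t p.1, (S.hist E t p.1 (Fin.last t)).1 +
        √(E.f (S.hist E t p.1 (Fin.last t)).2) * p.2)) ?_
    fun_prop

end InfoStrategy

end DynamicInfo

/-- Extending a Gaussian random walk from an intermediate value, then filling in an earlier one
from the Gaussian bridge. -/
theorem lintegral_extend_bridge {c₀ c₁ A C : ℝ} (h₀ : 0 ≤ c₀) (h₁ : 0 ≤ c₁) (hA : 0 ≤ A)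
    (hC : 0 ≤ C) (hsum : c₀ + c₁ = A + C) {φ : ℝ × ℝ → ℝ≥0∞} (hφ : Measurable φ) :
    ∫⁻ x, ∫⁻ e, ∫⁻ z, φ (A / (A + C) * (√c₀ * x + √c₁ * z) - √(A * C / (A + C)) * e,
        √c₀ * x + √c₁ * z) ∂(gaussianReal 0 1) ∂(gaussianReal 0 1) ∂(gaussianReal 0 1) =
      ∫⁻ x, ∫⁻ y, φ (√A * x, √A * x + √C * y) ∂(gaussianReal 0 1) ∂(gaussianReal 0 1) := by
  rw [← lintegral_bridge hA hC hφ, ← hsum]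
  -- Only the combination of `x` and `z` enters, and its law depends on `c₀ + c₁` alone. Moving `e`
  -- outermost lets the two draws merge into one of variance `A + C`.
  refine (lintegral_lintegral_swap ?_).trans (Eq.trans ?_ (lintegral_lintegral_swap ?_))
  rotate_left
  · refine lintegral_congr fun e => ?_
    exact lintegral_stdNormal_add h₀ h₁
      (φ := fun u => φ (A / (c₀ + c₁) * u - √(A * C / (c₀ + c₁)) * e, u)) (by fun_prop)
  · exact Measurable.aemeasurable (by fun_prop)
  refine Measurable.aemeasurable (Measurable.lintegral_prod_right' (f := fun p : (ℝ × ℝ) × ℝ =>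
    φ (A / (c₀ + c₁) * (√c₀ * p.1.1 + √c₁ * p.2) - √(A * C / (c₀ + c₁)) * p.1.2,
      √c₀ * p.1.1 + √c₁ * p.2)) ?_)
  fun_prop

namespace DynamicInfo

/-! ### Attainable sequences of divisions -/

theorem IsDivSeq.eq_zero {K : ℕ} {δ : DivSeq K 0} (h : IsDivSeq δ) : δ = 0 := by
  funext t i
  have h1 := h.1 t
  have ht : (t : ℕ) = 0 := by omega
  rw [ht, Finset.sum_eq_zero_iff] at h1
  exact h1 i (Finset.mem_univ i)

theorem isDivSeq_snoc {K t : ℕ} {δ : DivSeq K t} (h : IsDivSeq δ) (k : Fin K) :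
    IsDivSeq (Fin.snoc (α := fun _ => Division K) δ (δ (Fin.last t) + Pi.single k 1) :
      DivSeq K (t + 1)) := by
  constructor
  · intro s
    refine Fin.lastCases ?_ (fun s => ?_) s
    · rw [Fin.snoc_last]
      simp [Finset.sum_add_distrib, h.1, Pi.single_apply]
    · rw [Fin.snoc_castSucc]; exact h.1 s
  · rw [Fin.monotone_iff_le_succ]
    intro s
    rw [Fin.snoc_castSucc]
    refine Fin.lastCases ?_ (fun s => ?_) s
    · rw [Fin.succ_last, Fin.snoc_last]
      exact le_self_add
    · rw [← Fin.castSucc_succ, Fin.snoc_castSucc]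
      exact h.2 (Fin.castSucc_lt_succ).le

/-- The counts do not decrease and their total grows by one, so the difference is a vector of
naturals with sum one. -/
theorem IsDivSeq.exists_single {K t : ℕ} {δ : DivSeq K (t + 1)} (h : IsDivSeq δ) :
    ∃ k, δ (Fin.last (t + 1)) = δ (Fin.last t).castSucc + Pi.single k 1 := by
  have hle : δ (Fin.last t).castSucc ≤ δ (Fin.last (t + 1)) := h.2 (Fin.le_last _)
  obtain ⟨r, hr⟩ := exists_add_of_le hle
  have h1 := h.1 (Fin.last (t + 1))
  have h2 := h.1 (Fin.last t).castSucc
  rw [hr] at h1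
  simp only [Pi.add_apply, Finset.sum_add_distrib, Fin.val_last, Fin.val_castSucc] at h1 h2
  have h3 : ∑ i, r i = 1 := by omega
  obtain ⟨k, hk⟩ : ∃ k, r k ≠ 0 := by
    by_contra! hc
    simp [hc] at h3
  refine ⟨k, ?_⟩
  rw [hr]
  congr 1
  have h4 := Finset.add_sum_erase Finset.univ r (Finset.mem_univ k)
  have h5 : ∑ i ∈ Finset.univ.erase k, r i = 0 := by omega
  funext i
  by_cases hi : i = k
  · subst hi; simp; omega
  · rw [Pi.single_eq_of_ne hi]
    exact Finset.sum_eq_zero_iff.1 h5 i (by simp [hi])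

open Classical in
/-- The source observed in the last period of an attainable sequence. -/
noncomputable def lastSource {K t : ℕ} [NeZero K] (δ : DivSeq K (t + 1)) : Fin K :=
  -- The default is never reached by the simulating strategy when `G` is consistent: simulated
  -- divisions are always attainable and `G` keeps them so.
  if h : ∃ k, δ (Fin.last (t + 1)) = δ (Fin.last t).castSucc + Pi.single k 1 then h.choose else 0

theorem IsDivSeq.lastSource_spec {K t : ℕ} [NeZero K] {δ : DivSeq K (t + 1)} (h : IsDivSeq δ) :
    δ (Fin.last (t + 1)) = δ (Fin.last t).castSucc + Pi.single (lastSource δ) 1 := by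
  rw [lastSource, dif_pos h.exists_single]
  exact h.exists_single.choose_spec

@[fun_prop]
theorem measurable_divs {K T : ℕ} : Measurable (divs : Hist K T → DivSeq K T) := by
  unfold divs; fun_prop

@[fun_prop]
theorem Hist.measurable_init {K T : ℕ} : Measurable (Hist.init : Hist K (T + 1) → Hist K T) :=
  measurable_pi_lambda _ fun _ => measurable_pi_apply _

namespace InfoStrategy

variable {K : ℕ} (S : InfoStrategy K)

/-- The sequence of divisions after the observation that `S` prescribes in period `t + 1`. -/
def nextSeq (t : ℕ) (p : S.Seed × Hist K t) : DivSeq K (t + 1) :=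
  Fin.snoc (α := fun _ => Division K) (divs p.2) (S.nextDiv t p)

/-- The history extended by the observation that `S` prescribes, with posterior mean `m`. -/
def extend (t : ℕ) (s : S.Seed) (h : Hist K t) (m : ℝ) : Hist K (t + 1) :=
  Fin.snoc (α := fun _ => ℝ × Division K) h (m, S.nextDiv t (s, h))

@[fun_prop]
theorem measurable_nextSeq (t : ℕ) : Measurable (S.nextSeq t) := by
  refine measurable_pi_lambda _ fun i => ?_
  refine Fin.lastCases ?_ (fun i => ?_) i
  · simp only [nextSeq, Fin.snoc_last]; fun_prop
  · simp only [nextSeq, Fin.snoc_castSucc]; fun_prop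

@[fun_prop]
theorem measurable_extend (t : ℕ) :
    Measurable fun p : S.Seed × Hist K t × ℝ => S.extend t p.1 p.2.1 p.2.2 := by
  refine measurable_pi_lambda _ fun i => ?_
  refine Fin.lastCases ?_ (fun i => ?_) i
  · simp only [extend, Fin.snoc_last]; fun_prop
  · simp only [extend, Fin.snoc_castSucc]; fun_prop

@[simp]
theorem divs_extend (t : ℕ) (s : S.Seed) (h : Hist K t) (m : ℝ) :
    divs (S.extend t s h m) = S.nextSeq t (s, h) := by
  funext i
  refine Fin.lastCases ?_ (fun i => ?_) i
  · simp [divs, extend, nextSeq]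
  · simp [divs, extend, nextSeq]

@[simp]
theorem extend_last (t : ℕ) (s : S.Seed) (h : Hist K t) (m : ℝ) :
    S.extend t s h m (Fin.last (t + 1)) = (m, S.nextDiv t (s, h)) := by
  simp [extend]

@[simp]
theorem init_extend (t : ℕ) (s : S.Seed) (h : Hist K t) (m : ℝ) :
    (S.extend t s h m).init = h := by
  funext i; simp [extend, Hist.init]

@[simp]
theorem nextSeq_last (t : ℕ) (p : S.Seed × Hist K t) :
    S.nextSeq t p (Fin.last (t + 1)) = S.nextDiv t p := by
  simp [nextSeq]

theorem nextSeq_castSucc (t : ℕ) (p : S.Seed × Hist K t) :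
    (fun i : Fin (t + 1) => S.nextSeq t p i.castSucc) = divs p.2 := by
  funext i; simp [nextSeq]

theorem isDivSeq_nextSeq {t : ℕ} {p : S.Seed × Hist K t} (h : IsDivSeq (divs p.2)) :
    IsDivSeq (S.nextSeq t p) := isDivSeq_snoc h _

variable [NeZero K] (E : Environment K)

theorem hist_succ_eq_extend (t : ℕ) (ω : S.Sample) : S.hist E (t + 1) ω =
    S.extend t ω.2.2 (S.hist E t ω) (E.postMean (S.data E ω (t + 1))) :=
  S.hist_succ E t ω

theorem hist_zero (ω : S.Sample) : S.hist E 0 ω = fun _ => (E.priorMean 0, 0) := by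
  have hc : ∀ x : Data K 0, counts x = 0 := fun x => by funext k; simp [counts]
  have hm : ∀ x : Data K 0, E.postMean x = E.priorMean 0 := by
    intro x
    have h0 : E.postCov (0 : Division K) = E.priorCov := by
      have : Invertible E.priorCov.det :=
        ((Matrix.isUnit_iff_isUnit_det _).1 E.priorCov_posDef.isUnit).invertible
      simp only [Environment.postCov, Pi.zero_apply, Nat.cast_zero, zero_div,
        Matrix.diagonal_zero, Matrix.mul_zero, Matrix.zero_mul, add_zero]
      exact Matrix.nonsing_inv_nonsing_inv _ (isUnit_of_invertible _)
    simp only [Environment.postMean, hc, h0, Finset.univ_eq_empty, Finset.sum_empty, add_zero]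
    rw [Matrix.mulVec_mulVec, E.priorCov_mul_inv, Matrix.one_mulVec]
  funext i
  have hi : i = Fin.last 0 := Fin.ext (by have := i.isLt; rw [Fin.val_last]; omega)
  subst hi
  rw [hist_last, hc, hm]

theorem isDivSeq_divs_hist (t : ℕ) (ω : S.Sample) : IsDivSeq (divs (S.hist E t ω)) := by
  induction t with
  | zero =>
    rw [hist_zero]
    exact ⟨fun i => by simp [divs], fun _ _ _ => le_rfl⟩
  | succ t ih =>
    rw [hist_succ_eq_extend, divs_extend]
    exact S.isDivSeq_nextSeq ih

/-! ### The simulating strategy -/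

variable (G : ∀ T : ℕ, DivSeq K T → DivSeq K T)

/-- The variance of the increment of the posterior mean in period `t + 1` under `S`. -/
noncomputable def stepVar (t : ℕ) (p : S.Seed × Hist K t) : ℝ :=
  E.f (p.2 (Fin.last t)).2 - E.f (S.nextDiv t p)

/-- The reduction of the posterior variance through the mapping `G`. -/
noncomputable def _root_.DynamicInfo.Environment.varGap {T : ℕ} (δ : DivSeq K T) : ℝ :=
  E.f (δ (Fin.last T)) - E.f (G T δ (Fin.last T))

/-- The simulated posterior mean of period `t + 1`: a draw from the Gaussian bridge between the
simulated mean of period `t` and the observed mean `ν` of period `t + 1`, with innovation `e`. -/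
noncomputable def bridge (t : ℕ) (p : S.Seed × Hist K t) (ν e : ℝ) : ℝ :=
  (p.2 (Fin.last t)).1 +
    (S.stepVar E t p / (S.stepVar E t p + E.varGap G (S.nextSeq t p)) *
        (ν - (p.2 (Fin.last t)).1) -
      √(S.stepVar E t p * E.varGap G (S.nextSeq t p) /
        (S.stepVar E t p + E.varGap G (S.nextSeq t p))) * e)

/-- The simulated history under `S`, given the seed of `S`, the innovations, and an observed
history. -/
noncomputable def sim : ∀ t : ℕ, (S.Seed × (ℕ → ℝ)) × Hist K t → Hist K t
  | 0, _ => fun _ => (E.priorMean 0, 0)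
  -- The observed history enters only through its means. The simulated division of period `t + 1`
  -- depends on the seed and the simulated history up to `t`, hence is known before the new mean is
  -- drawn.
  | t + 1, p => S.extend t p.1.1 (sim t (p.1, p.2.init))
      (S.bridge E G t (p.1.1, sim t (p.1, p.2.init)) (p.2 (Fin.last (t + 1))).1 (p.1.2 t))

@[fun_prop]
theorem measurable_stepVar (t : ℕ) : Measurable (S.stepVar E t) := by
  have hf : Measurable E.f := measurable_of_countable _
  unfold stepVar; fun_prop

@[fun_prop]
theorem _root_.DynamicInfo.Environment.measurable_varGap {T : ℕ} :
    Measurable (E.varGap G : DivSeq K T → ℝ) := measurable_of_countable _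

@[fun_prop]
theorem measurable_bridge (t : ℕ) :
    Measurable fun q : (S.Seed × Hist K t) × ℝ × ℝ => S.bridge E G t q.1 q.2.1 q.2.2 := by
  unfold bridge; fun_prop

@[fun_prop]
theorem measurable_sim (t : ℕ) : Measurable (S.sim E G t) := by
  induction t with
  | zero => exact measurable_const
  | succ t ih =>
    have h1 : Measurable fun p : (S.Seed × (ℕ → ℝ)) × Hist K (t + 1) =>
        S.sim E G t (p.1, p.2.init) := by fun_prop
    have h2 : Measurable fun p : (S.Seed × (ℕ → ℝ)) × Hist K (t + 1) =>
        S.bridge E G t (p.1.1, S.sim E G t (p.1, p.2.init)) (p.2 (Fin.last (t + 1))).1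
          (p.1.2 t) :=
      (S.measurable_bridge E G t).comp ((by fun_prop : Measurable fun p :
        (S.Seed × (ℕ → ℝ)) × Hist K (t + 1) => (p.1.1, S.sim E G t (p.1, p.2.init))).prodMk
        (by fun_prop : Measurable fun p : (S.Seed × (ℕ → ℝ)) × Hist K (t + 1) =>
          ((p.2 (Fin.last (t + 1))).1, p.1.2 t)))
    exact (S.measurable_extend t).comp ((by fun_prop : Measurable fun p :
      (S.Seed × (ℕ → ℝ)) × Hist K (t + 1) => p.1.1).prodMk (h1.prodMk h2))

/-- The strategy that simulates a history under `S` and observes the sources according to the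
remapped divisions. -/
noncomputable def simulator : InfoStrategy K where
  Seed := S.Seed × (ℕ → ℝ)
  seedLaw := S.seedLaw.prod (Measure.infinitePi fun _ => gaussianReal 0 1)
  choose t p := lastSource (G (t + 1) (S.nextSeq t (p.1.1, S.sim E G t p)))
  measurable_choose t := by
    refine (measurable_of_countable fun δ => lastSource (G (t + 1) δ)).comp ?_
    exact (S.measurable_nextSeq t).comp
      ((measurable_fst.comp measurable_fst).prodMk (S.measurable_sim E G t))

/-- The simulated history, as a random variable under the simulating strategy. -/
noncomputable def simHist (t : ℕ) (ω : (S.simulator E G).Sample) : Hist K t :=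
  S.sim E G t (ω.2.2, (S.simulator E G).hist E t ω)

@[fun_prop]
theorem measurable_simHist (t : ℕ) : Measurable (S.simHist E G t) :=
  (S.measurable_sim E G t).comp ((measurable_snd.comp measurable_snd).prodMk
    ((S.simulator E G).measurable_hist E t))

theorem simHist_succ (t : ℕ) (ω : (S.simulator E G).Sample) :
    S.simHist E G (t + 1) ω = S.extend t ω.2.2.1 (S.simHist E G t ω)
      (S.bridge E G t (ω.2.2.1, S.simHist E G t ω)
        (E.postMean ((S.simulator E G).data E ω (t + 1))) (ω.2.2.2 t)) := by
  rw [simHist, sim, init_hist]; rfl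

theorem init_simHist (t : ℕ) (ω : (S.simulator E G).Sample) :
    (S.simHist E G (t + 1) ω).init = S.simHist E G t ω := by
  rw [simHist_succ, init_extend]

theorem isDivSeq_divs_sim (t : ℕ) (p : (S.Seed × (ℕ → ℝ)) × Hist K t) :
    IsDivSeq (divs (S.sim E G t p)) := by
  induction t with
  | zero => exact ⟨fun i => by simp [divs, sim], fun _ _ _ => le_rfl⟩
  | succ t ih =>
    rw [sim, divs_extend]
    exact S.isDivSeq_nextSeq (ih _)

variable {G}

/-- Holds at every sample point. Nestedness identifies the earlier entries of the remapped sequence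
with the divisions already reached, and attainability makes its last entry reachable by one more
observation. -/
theorem divs_hist_simulator (hG : IsConsistent G) (t : ℕ) (ω : (S.simulator E G).Sample) :
    divs ((S.simulator E G).hist E t ω) = G t (divs (S.simHist E G t ω)) := by
  induction t with
  | zero =>
    exact (isDivSeq_divs_hist _ E 0 ω).eq_zero.trans
      (hG.attainable 0 _ (S.isDivSeq_divs_sim E G 0 _)).eq_zero.symm
  | succ t ih =>
    have hs : IsDivSeq (S.nextSeq t (ω.2.2.1, S.simHist E G t ω)) :=
      S.isDivSeq_nextSeq (S.isDivSeq_divs_sim E G t _)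
    have hn := hG.nested t _ hs
    rw [nextSeq_castSucc] at hn
    change _ = G t (divs (S.simHist E G t ω)) at hn
    rw [hist_succ_eq_extend, divs_extend, simHist_succ, divs_extend]
    funext i
    refine Fin.lastCases ?_ (fun i => ?_) i
    · rw [nextSeq_last, (hG.attainable _ _ hs).lastSource_spec]
      have h1 := congrFun hn (Fin.last t)
      beta_reduce at h1
      rw [h1, ← ih]
      rfl
    · have h1 := congrFun hn i
      beta_reduce at h1
      rw [h1, ← ih]
      simp [nextSeq]

theorem nextDiv_simulator (hG : IsConsistent G) (t : ℕ) (ω : (S.simulator E G).Sample) :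
    (S.simulator E G).nextDiv t (ω.2.2, (S.simulator E G).hist E t ω) =
      G (t + 1) (S.nextSeq t (ω.2.2.1, S.simHist E G t ω)) (Fin.last (t + 1)) := by
  have h := congrFun (S.divs_hist_simulator E hG (t + 1) ω) (Fin.last (t + 1))
  rw [hist_succ_eq_extend, divs_extend, simHist_succ, divs_extend, nextSeq_last] at h
  exact h

variable (G)

/-- Innovation `u` is first used in passing from period `u` to `u + 1`. -/
theorem sim_update {t u : ℕ} (htu : t ≤ u) (s : S.Seed) (ξ : ℕ → ℝ) (e : ℝ) (h : Hist K t) :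
    S.sim E G t ((s, Function.update ξ u e), h) = S.sim E G t ((s, ξ), h) := by
  induction t with
  | zero => rfl
  | succ t ih =>
    have h1 : t ≠ u := by omega
    simp only [sim, ih (Nat.le_of_succ_le htu), Function.update_of_ne h1]

theorem data_update {t u : ℕ} (htu : t ≤ u) (θ : EuclideanSpace ℝ (Fin K))
    (ε : ℕ → Fin K → ℝ) (s : S.Seed) (ξ : ℕ → ℝ) (e : ℝ) :
    (S.simulator E G).data E (θ, ε, (s, Function.update ξ u e)) t =
      (S.simulator E G).data E (θ, ε, (s, ξ)) t := by
  induction t with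
  | zero => rfl
  | succ t ih =>
    have h1 : ∀ h : Hist K t, (S.simulator E G).choose t ((s, Function.update ξ u e), h) =
        (S.simulator E G).choose t ((s, ξ), h) := by
      intro h
      simp only [simulator]
      rw [sim_update S E G (by omega)]
    simp only [data]
    rw [ih (Nat.le_of_succ_le htu), h1]

/-- The innovation of period `t + 1` may be redrawn independently of everything else. -/
theorem lintegral_simulator_update (t : ℕ) {Φ : (S.simulator E G).Sample → ℝ≥0∞}
    (hΦ : Measurable Φ) :
    ∫⁻ ω, Φ ω ∂((S.simulator E G).prob E) =
      ∫⁻ ω, ∫⁻ e, Φ (ω.1, ω.2.1, (ω.2.2.1, Function.update ω.2.2.2 t e)) ∂(gaussianReal 0 1)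
        ∂((S.simulator E G).prob E) := by
  have hu : Measurable fun p : (ℕ → ℝ) × ℝ => Function.update p.1 t p.2 := by
    refine measurable_pi_lambda _ fun i => ?_
    by_cases h : i = t
    · subst h; simpa using measurable_snd
    · simp only [Function.update_of_ne h]; fun_prop
  have hΨ : Measurable fun ω : (S.simulator E G).Sample =>
      ∫⁻ e, Φ (ω.1, ω.2.1, (ω.2.2.1, Function.update ω.2.2.2 t e)) ∂(gaussianReal 0 1) := by
    refine Measurable.lintegral_prod_right' (f := fun p : (S.simulator E G).Sample × ℝ =>
      Φ (p.1.1, p.1.2.1, (p.1.2.2.1, Function.update p.1.2.2.2 t p.2))) (hΦ.comp ?_)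
    refine (by fun_prop : Measurable fun p : (S.simulator E G).Sample × ℝ => p.1.1).prodMk
      ((by fun_prop : Measurable fun p : (S.simulator E G).Sample × ℝ => p.1.2.1).prodMk ?_)
    have h1 : Measurable fun p : (S.simulator E G).Sample × ℝ => p.1.2.2 := by fun_prop
    exact (measurable_fst.comp h1).prodMk (hu.comp ((measurable_snd.comp h1).prodMk measurable_snd))
  rw [lintegral_prob _ _ hΦ, lintegral_prob _ _ hΨ]
  set Q := (multivariateGaussian E.priorMean E.priorCov).prod
    (Measure.infinitePi fun _ : ℕ => Measure.pi fun k : Fin K => gaussianReal 0 (E.noiseVar k))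
  have hF : Measurable fun r : S.Seed × (ℕ → ℝ) => ∫⁻ p, Φ (p.1, p.2, r) ∂Q :=
    Measurable.lintegral_prod_right' (f := fun q : (S.Seed × (ℕ → ℝ)) ×
      (EuclideanSpace ℝ (Fin K) × (ℕ → Fin K → ℝ)) => Φ (q.2.1, q.2.2, q.1))
      (hΦ.comp ((measurable_fst.comp measurable_snd).prodMk
        ((measurable_snd.comp measurable_snd).prodMk measurable_fst)))
  have hH : Measurable fun r : S.Seed × (ℕ → ℝ) => ∫⁻ p, ∫⁻ e,
      Φ (p.1, p.2, (r.1, Function.update r.2 t e)) ∂(gaussianReal 0 1) ∂Q :=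
    Measurable.lintegral_prod_right' (f := fun q : (S.Seed × (ℕ → ℝ)) ×
      (EuclideanSpace ℝ (Fin K) × (ℕ → Fin K → ℝ)) => ∫⁻ e,
        Φ (q.2.1, q.2.2, (q.1.1, Function.update q.1.2 t e)) ∂(gaussianReal 0 1))
      (hΨ.comp ((measurable_fst.comp measurable_snd).prodMk
        ((measurable_snd.comp measurable_snd).prodMk measurable_fst)))
  refine (lintegral_prod _ hF.aemeasurable).trans
    (Eq.trans ?_ (lintegral_prod _ hH.aemeasurable).symm)
  refine lintegral_congr fun s => ?_
  refine (lintegral_update_infinitePi (fun _ : ℕ => gaussianReal 0 1) t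
    (hF.comp measurable_prodMk_left)).trans (lintegral_congr fun ξ => ?_)
  refine lintegral_lintegral_swap (f := fun e
    (p : EuclideanSpace ℝ (Fin K) × (ℕ → Fin K → ℝ)) =>
      Φ (p.1, p.2, (s, Function.update ξ t e)))
    (Measurable.aemeasurable (hΦ.comp ?_))
  exact (measurable_fst.comp measurable_snd).prodMk ((measurable_snd.comp measurable_snd).prodMk
    (measurable_const.prodMk (hu.comp (measurable_const.prodMk measurable_fst))))

end InfoStrategy

end DynamicInfo

namespace DynamicInfo.InfoStrategy

/-! ### The joint law of simulated and observed histories -/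

variable {K : ℕ} (S : InfoStrategy K) (E : Environment K)

theorem measurePreserving_seed :
    MeasurePreserving (fun ω : S.Sample => ω.2.2) (S.prob E) S.seedLaw :=
  measurePreserving_snd.comp measurePreserving_snd

variable [NeZero K] {G : ∀ T : ℕ, DivSeq K T → DivSeq K T}

variable (G) in
theorem measurePreserving_simulator_seed :
    MeasurePreserving (fun ω : (S.simulator E G).Sample => ω.2.2.1) ((S.simulator E G).prob E)
      S.seedLaw :=
  (measurePreserving_fst (μ := S.seedLaw) (ν := Measure.infinitePi fun _ => gaussianReal 0 1)).comp
    (measurePreserving_seed (S.simulator E G) E)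

/-- The hypothesis covers realized sequences only; there are countably many sequences of divisions,
so the unrealized ones together are null. -/
theorem ae_varGap_nonneg (hf : ∀ (T : ℕ) (δ : DivSeq K T), S.Realized E δ →
    E.f (G T δ (Fin.last T)) ≤ E.f (δ (Fin.last T))) (T : ℕ) :
    ∀ᵐ ω ∂(S.prob E), 0 ≤ E.varGap G (divs (S.hist E T ω)) := by
  have h1 : ∀ᵐ h ∂(S.law E T), S.Realized E (divs h) := by
    have h2 : ∀ δ : DivSeq K T, ∀ᵐ h ∂(S.law E T), divs h = δ → S.Realized E δ := by
      intro δ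
      by_cases hδ : S.Realized E δ
      · exact ae_of_all _ fun _ _ => hδ
      · rw [Realized, not_not] at hδ
        rw [ae_iff]
        refine measure_mono_null (fun h hh => ?_) hδ
        simp only [Set.mem_ofPred_eq] at hh ⊢
        by_contra hc
        exact hh fun h => absurd h hc
    filter_upwards [ae_all_iff.2 h2] with h hh using hh _ rfl
  filter_upwards [ae_of_ae_map (S.measurable_hist E T).aemeasurable h1] with ω hω
  exact sub_nonneg.2 (hf T _ hω)

theorem stepVar_nonneg (t : ℕ) (p : S.Seed × Hist K t) : 0 ≤ S.stepVar E t p :=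
  sub_nonneg.2 (E.f_antitone le_self_add)

/-- By nestedness both divisions belong to one attainable, hence monotone, sequence, and
`f_antitone` applies. The difference is the variance of the next step of the observed mean. -/
theorem f_remapped_step_nonneg (hG : IsConsistent G) (t : ℕ) (p : S.Seed × Hist K t)
    (hp : IsDivSeq (divs p.2)) :
    0 ≤ E.f (G t (divs p.2) (Fin.last t)) - E.f (G (t + 1) (S.nextSeq t p) (Fin.last (t + 1))) := by
  have hs := S.isDivSeq_nextSeq hp
  have h1 := congrFun (hG.nested t _ hs) (Fin.last t)
  rw [nextSeq_castSucc] at h1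
  rw [← h1]
  exact sub_nonneg.2 (E.f_antitone ((hG.attainable _ _ hs).2 (Fin.le_last _)))

/-- Given the history under `S`, the posterior mean under the simulating strategy is normal around
the posterior mean under `S`. -/
theorem lintegral_simulator (hG : IsConsistent G)
    (hf : ∀ (T : ℕ) (δ : DivSeq K T), S.Realized E δ →
      E.f (G T δ (Fin.last T)) ≤ E.f (δ (Fin.last T))) (t : ℕ)
    {φ : S.Seed × Hist K t × ℝ → ℝ≥0∞} (hφ : Measurable φ) :
    ∫⁻ ω, φ (ω.2.2.1, S.simHist E G t ω, ((S.simulator E G).hist E t ω (Fin.last t)).1)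
        ∂((S.simulator E G).prob E) =
      ∫⁻ ω, ∫⁻ z, φ (ω.2.2, S.hist E t ω, (S.hist E t ω (Fin.last t)).1 +
        √(E.varGap G (divs (S.hist E t ω))) * z) ∂(gaussianReal 0 1) ∂(S.prob E) := by
  have hEf : Measurable E.f := measurable_of_countable _
  induction t with
  | zero =>
    let h0 : Hist K 0 := fun _ => (E.priorMean 0, 0)
    have hgap : E.varGap G (divs h0) = 0 := by
      have hd : IsDivSeq (divs h0) := ⟨fun i => by simp [divs, h0], fun _ _ _ => le_rfl⟩
      rw [Environment.varGap, (hG.attainable 0 _ hd).eq_zero, hd.eq_zero, sub_self]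
    have h1 : ∀ ω, φ (ω.2.2.1, S.simHist E G 0 ω,
        ((S.simulator E G).hist E 0 ω (Fin.last 0)).1) = φ (ω.2.2.1, h0, E.priorMean 0) := by
      intro ω; rw [hist_zero]; rfl
    have h2 : ∀ ω : S.Sample, ∫⁻ z, φ (ω.2.2, S.hist E 0 ω, (S.hist E 0 ω (Fin.last 0)).1 +
        √(E.varGap G (divs (S.hist E 0 ω))) * z) ∂(gaussianReal 0 1) =
        φ (ω.2.2, h0, E.priorMean 0) := by
      intro ω
      rw [hist_zero]
      change ∫⁻ z, φ (ω.2.2, h0, E.priorMean 0 + √(E.varGap G (divs h0)) * z) ∂_ = _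
      simp [hgap]
    simp only [h2]
    rw [lintegral_congr h1]
    have hm : Measurable fun s => φ (s, h0, E.priorMean 0) := by fun_prop
    exact ((S.measurePreserving_simulator_seed E G).lintegral_comp hm).trans
      ((S.measurePreserving_seed E).lintegral_comp hm).symm
  | succ t ih =>
    -- The variance of the next step of the observed mean, as a function of seed and simulated
    -- history only; this is what allows the induction to forget the earlier observed means.
    let c : S.Seed × Hist K t → ℝ := fun p => E.f (G t (divs p.2) (Fin.last t)) -
      E.f (G (t + 1) (S.nextSeq t p) (Fin.last (t + 1)))
    have hc : Measurable c := by
      have h1 : Measurable fun δ : DivSeq K t => E.f (G t δ (Fin.last t)) :=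
        measurable_of_countable _
      have h2 : Measurable fun δ : DivSeq K (t + 1) => E.f (G (t + 1) δ (Fin.last (t + 1))) :=
        measurable_of_countable _
      exact (h1.comp (by fun_prop)).sub (h2.comp (by fun_prop))
    let φ' : (S.Seed × Hist K t) × ℝ × ℝ → ℝ≥0∞ := fun q =>
      φ (q.1.1, S.extend t q.1.1 q.1.2 q.2.1, q.2.2)
    have hφ' : Measurable φ' := hφ.comp ((by fun_prop : Measurable
      fun q : (S.Seed × Hist K t) × ℝ × ℝ => q.1.1).prodMk (((S.measurable_extend t).comp
        (by fun_prop : Measurable fun q : (S.Seed × Hist K t) × ℝ × ℝ =>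
          (q.1.1, q.1.2, q.2.1))).prodMk (by fun_prop)))
    let Ψ : (S.Seed × Hist K t) × ℝ × ℝ → ℝ≥0∞ := fun q =>
      ∫⁻ z, φ' (q.1, S.bridge E G t q.1 (q.2.1 + √(c q.1) * z) q.2.2, q.2.1 + √(c q.1) * z)
        ∂(gaussianReal 0 1)
    have hbr : Measurable fun q : ((S.Seed × Hist K t) × ℝ × ℝ) × ℝ =>
        S.bridge E G t q.1.1 (q.1.2.1 + √(c q.1.1) * q.2) q.1.2.2 :=
      (S.measurable_bridge E G t).comp (by fun_prop : Measurable
        fun q : ((S.Seed × Hist K t) × ℝ × ℝ) × ℝ =>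
          (q.1.1, q.1.2.1 + √(c q.1.1) * q.2, q.1.2.2))
    have hΨ : Measurable Ψ := by
      refine Measurable.lintegral_prod_right' (f := fun q : ((S.Seed × Hist K t) × ℝ × ℝ) × ℝ =>
        φ' (q.1.1, S.bridge E G t q.1.1 (q.1.2.1 + √(c q.1.1) * q.2) q.1.2.2,
          q.1.2.1 + √(c q.1.1) * q.2)) (hφ'.comp ?_)
      fun_prop
    -- integrate out the new observation under the simulating strategy
    have step1 : ∫⁻ ω, φ (ω.2.2.1, S.simHist E G (t + 1) ω,
          ((S.simulator E G).hist E (t + 1) ω (Fin.last (t + 1))).1)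
          ∂((S.simulator E G).prob E) =
        ∫⁻ ω, Ψ ((ω.2.2.1, S.simHist E G t ω),
          ((S.simulator E G).hist E t ω (Fin.last t)).1, ω.2.2.2 t)
          ∂((S.simulator E G).prob E) := by
      have hm : Measurable fun q : (S.simulator E G).Seed × Hist K t × ℝ =>
          φ' ((q.1.1, S.sim E G t (q.1, q.2.1)),
            S.bridge E G t (q.1.1, S.sim E G t (q.1, q.2.1)) q.2.2 (q.1.2 t), q.2.2) := by
        have e1 : Measurable fun q : (S.Seed × (ℕ → ℝ)) × Hist K t × ℝ =>
            ((q.1.1, S.sim E G t (q.1, q.2.1)), q.2.2, q.1.2 t) := by fun_prop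
        have e2 := (S.measurable_bridge E G t).comp e1
        exact hφ'.comp ((by fun_prop : Measurable fun q : (S.Seed × (ℕ → ℝ)) × Hist K t × ℝ =>
          (q.1.1, S.sim E G t (q.1, q.2.1))).prodMk (e2.prodMk (by fun_prop)))
      have h := (S.simulator E G).lintegral_next_mean E t hm
      refine Eq.trans (lintegral_congr fun ω => ?_) (h.trans (lintegral_congr fun ω => ?_))
      · rw [simHist_succ, hist_last]; rfl
      · rw [S.nextDiv_simulator E hG]
        have h2 := congrFun (S.divs_hist_simulator E hG t ω) (Fin.last t)
        change ((S.simulator E G).hist E t ω (Fin.last t)).2 = _ at h2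
        rw [h2]
        rfl
    -- redraw the innovation and use the induction hypothesis
    have step2 : ∫⁻ ω, Ψ ((ω.2.2.1, S.simHist E G t ω),
          ((S.simulator E G).hist E t ω (Fin.last t)).1, ω.2.2.2 t)
          ∂((S.simulator E G).prob E) =
        ∫⁻ ω, ∫⁻ z, ∫⁻ e, Ψ ((ω.2.2, S.hist E t ω), (S.hist E t ω (Fin.last t)).1 +
          √(E.varGap G (divs (S.hist E t ω))) * z, e) ∂(gaussianReal 0 1) ∂(gaussianReal 0 1)
          ∂(S.prob E) := by
      have hm : Measurable fun ω : (S.simulator E G).Sample =>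
          Ψ ((ω.2.2.1, S.simHist E G t ω),
            ((S.simulator E G).hist E t ω (Fin.last t)).1, ω.2.2.2 t) := by
        have e1 : Measurable fun ω : (S.simulator E G).Sample => ω.2.2 := by fun_prop
        have e2 : Measurable fun ω : (S.simulator E G).Sample => ω.2.2.1 := measurable_fst.comp e1
        have e3 : Measurable fun ω : (S.simulator E G).Sample => ω.2.2.2 t :=
          (measurable_pi_apply t).comp (measurable_snd.comp e1)
        exact hΨ.comp ((e2.prodMk (S.measurable_simHist E G t)).prodMk
          (Measurable.prodMk (by fun_prop) e3))
      -- The induction hypothesis says nothing about the innovation of this period jointly with the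
      -- rest, so it is first replaced by a fresh draw `e`.
      rw [S.lintegral_simulator_update E G t hm]
      have hm2 : Measurable fun q : S.Seed × Hist K t × ℝ =>
          ∫⁻ e, Ψ ((q.1, q.2.1), q.2.2, e) ∂(gaussianReal 0 1) :=
        Measurable.lintegral_prod_right' (f := fun q : (S.Seed × Hist K t × ℝ) × ℝ =>
          Ψ ((q.1.1, q.1.2.1), q.1.2.2, q.2)) (by fun_prop)
      refine Eq.trans (lintegral_congr fun ω => lintegral_congr fun e => ?_) (ih hm2)
      have d1 := S.data_update E G le_rfl (t := t) ω.1 ω.2.1 ω.2.2.1 ω.2.2.2 e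
      simp only [simHist, hist]
      rw [d1, S.sim_update E G le_rfl, Function.update_self]
      rfl
    -- compare with the step under `S`
    have step3 : ∀ᵐ ω ∂(S.prob E), (∫⁻ z, ∫⁻ e, Ψ ((ω.2.2, S.hist E t ω),
          (S.hist E t ω (Fin.last t)).1 + √(E.varGap G (divs (S.hist E t ω))) * z, e)
          ∂(gaussianReal 0 1) ∂(gaussianReal 0 1)) =
        ∫⁻ x, ∫⁻ y, φ' ((ω.2.2, S.hist E t ω),
          (S.hist E t ω (Fin.last t)).1 + √(S.stepVar E t (ω.2.2, S.hist E t ω)) * x,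
          (S.hist E t ω (Fin.last t)).1 + √(S.stepVar E t (ω.2.2, S.hist E t ω)) * x +
            √(E.varGap G (S.nextSeq t (ω.2.2, S.hist E t ω))) * y)
          ∂(gaussianReal 0 1) ∂(gaussianReal 0 1) := by
      filter_upwards [S.ae_varGap_nonneg E hf t, S.ae_varGap_nonneg E hf (t + 1)] with ω h0 h1
      rw [hist_succ_eq_extend, divs_extend] at h1
      set p : S.Seed × Hist K t := (ω.2.2, S.hist E t ω) with hp
      -- Both sides equal f(d(t)) - f(d̃(t+1)): one route passes through the remapped division at
      -- `t`, the other through the division of `S` at `t + 1`.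
      have hsum : E.varGap G (divs p.2) + c p =
          S.stepVar E t p + E.varGap G (S.nextSeq t p) := by
        simp only [Environment.varGap, c, stepVar, nextSeq_last, divs]; ring
      have h := lintegral_extend_bridge h0
        (S.f_remapped_step_nonneg E hG t p (S.isDivSeq_divs_hist E t ω))
        (S.stepVar_nonneg E t p) h1 hsum
        (φ := fun q => φ' (p, (p.2 (Fin.last t)).1 + q.1, (p.2 (Fin.last t)).1 + q.2))
        (by fun_prop)
      refine Eq.trans ?_ (h.trans ?_)
      · refine lintegral_congr fun z => lintegral_congr fun e => lintegral_congr fun x => ?_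
        congr 2
        simp only [bridge, c, hp, Prod.mk.injEq]
        constructor
        · congr 2
          ring
        · ring
      · simp only [hp, add_assoc]
    have step4 : ∫⁻ ω, ∫⁻ x, ∫⁻ y, φ' ((ω.2.2, S.hist E t ω),
          (S.hist E t ω (Fin.last t)).1 + √(S.stepVar E t (ω.2.2, S.hist E t ω)) * x,
          (S.hist E t ω (Fin.last t)).1 + √(S.stepVar E t (ω.2.2, S.hist E t ω)) * x +
            √(E.varGap G (S.nextSeq t (ω.2.2, S.hist E t ω))) * y)
          ∂(gaussianReal 0 1) ∂(gaussianReal 0 1) ∂(S.prob E) =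
        ∫⁻ ω, ∫⁻ y, φ (ω.2.2, S.hist E (t + 1) ω, (S.hist E (t + 1) ω (Fin.last (t + 1))).1 +
          √(E.varGap G (divs (S.hist E (t + 1) ω))) * y) ∂(gaussianReal 0 1) ∂(S.prob E) := by
      have hm : Measurable fun q : S.Seed × Hist K t × ℝ => ∫⁻ y, φ' ((q.1, q.2.1), q.2.2,
          q.2.2 + √(E.varGap G (S.nextSeq t (q.1, q.2.1))) * y) ∂(gaussianReal 0 1) :=
        Measurable.lintegral_prod_right' (f := fun q : (S.Seed × Hist K t × ℝ) × ℝ =>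
          φ' ((q.1.1, q.1.2.1), q.1.2.2,
            q.1.2.2 + √(E.varGap G (S.nextSeq t (q.1.1, q.1.2.1))) * q.2)) (by fun_prop)
      -- The draw `x` is the next step of the mean under `S`; read backwards, the conditional law
      -- reassembles the history of period `t + 1`.
      refine (S.lintegral_next_mean E t hm).symm.trans (lintegral_congr fun ω => ?_)
      rw [hist_succ_eq_extend, divs_extend, extend_last]
    rw [step1, step2, lintegral_congr_ae step3, step4]

end DynamicInfo.InfoStrategy

/-! ### Equality of joint laws with the state, and of payoffs -/

namespace DynamicInfo

theorem Hist.eq_of_init {K : ℕ} {Ω : Type*} (H : ∀ t, Ω → Hist K t)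
    (hH : ∀ t ω, (H (t + 1) ω).init = H t ω) {m n : ℕ} (h : m ≤ n) (ω : Ω) :
    H m ω = fun i => H n ω (i.castLE (Nat.succ_le_succ h)) := by
  induction n, h using Nat.le_induction with
  | base => rfl
  | succ n hmn ih =>
    rw [ih, ← hH n]; rfl

namespace InfoStrategy

variable {K : ℕ} (S : InfoStrategy K) [NeZero K] (E : Environment K)
  {G : ∀ T : ℕ, DivSeq K T → DivSeq K T}

/-- The simulated history is distributed jointly with the seed and the state like the history
under the simulated strategy. -/
theorem map_simHist_state (hG : IsConsistent G)
    (hf : ∀ (T : ℕ) (δ : DivSeq K T), S.Realized E δ →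
      E.f (G T δ (Fin.last T)) ≤ E.f (δ (Fin.last T))) (t : ℕ) :
    ((S.simulator E G).prob E).map (fun ω => (ω.2.2.1, S.simHist E G t ω, ω.1 0)) =
      (S.prob E).map (fun ω => (ω.2.2, S.hist E t ω, ω.1 0)) := by
  have hEf : Measurable E.f := measurable_of_countable _
  have hGf : Measurable fun δ : DivSeq K t => E.f (G t δ (Fin.last t)) :=
    measurable_of_countable _
  have hθ : Measurable fun ω : (S.simulator E G).Sample => ω.1 0 := by fun_prop
  have hs := (S.measurePreserving_simulator_seed E G).measurable
  refine Measure.ext_of_lintegral _ fun φ hφ => ?_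
  rw [lintegral_map hφ (hs.prodMk ((S.measurable_simHist E G t).prodMk hθ)),
    lintegral_map hφ (by fun_prop)]
  have hm1 : Measurable fun q : (S.simulator E G).Seed × Hist K t × ℝ =>
      φ (q.1.1, S.sim E G t (q.1, q.2.1), q.2.2) := by
    refine hφ.comp ?_
    exact (by fun_prop : Measurable fun q : (S.Seed × (ℕ → ℝ)) × Hist K t × ℝ =>
      (q.1.1, S.sim E G t (q.1, q.2.1), q.2.2))
  have hm2 : Measurable fun q : S.Seed × Hist K t × ℝ => ∫⁻ z, φ (q.1, q.2.1,
      q.2.2 + √(E.f (G t (divs q.2.1) (Fin.last t))) * z) ∂(gaussianReal 0 1) := by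
    refine Measurable.lintegral_prod_right' (f := fun q : (S.Seed × Hist K t × ℝ) × ℝ =>
      φ (q.1.1, q.1.2.1, q.1.2.2 + √(E.f (G t (divs q.1.2.1) (Fin.last t))) * q.2)) ?_
    have h1 : Measurable fun q : (S.Seed × Hist K t × ℝ) × ℝ =>
        E.f (G t (divs q.1.2.1) (Fin.last t)) := hGf.comp (by fun_prop)
    fun_prop
  -- First θ₁ is drawn around the observed mean, then the observed mean around the simulated one;
  -- the two normal draws add up to variance f(d(t)).
  refine ((S.simulator E G).lintegral_state E t hm1).trans ?_
  refine Eq.trans (lintegral_congr fun ω => ?_)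
    ((S.lintegral_simulator E hG hf t hm2).trans ?_)
  · have h2 := congrFun (S.divs_hist_simulator E hG t ω) (Fin.last t)
    change ((S.simulator E G).hist E t ω (Fin.last t)).2 = _ at h2
    rw [h2]; rfl
  · rw [S.lintegral_state E t hφ]
    refine lintegral_congr_ae ?_
    filter_upwards [S.ae_varGap_nonneg E hf t] with ω h0
    have h := lintegral_stdNormal_add h0 (E.f_nonneg (G t (divs (S.hist E t ω)) (Fin.last t)))
      (φ := fun u => φ (ω.2.2, S.hist E t ω, (S.hist E t ω (Fin.last t)).1 + u)) (by fun_prop)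
    have e : E.varGap G (divs (S.hist E t ω)) + E.f (G t (divs (S.hist E t ω)) (Fin.last t)) =
        E.f (S.hist E t ω (Fin.last t)).2 := by
      simp [Environment.varGap, divs]
    rw [e] at h
    simpa only [add_assoc] using h

/-- The equality of laws in `map_simHist_state`, for the histories of all periods at once. -/
theorem map_simHist_state_all (hG : IsConsistent G)
    (hf : ∀ (T : ℕ) (δ : DivSeq K T), S.Realized E δ →
      E.f (G T δ (Fin.last T)) ≤ E.f (δ (Fin.last T))) :
    ((S.simulator E G).prob E).map (fun ω t => (ω.2.2.1, S.simHist E G t ω, ω.1 0)) =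
      (S.prob E).map (fun ω t => (ω.2.2, S.hist E t ω, ω.1 0)) := by
  have hθ : Measurable fun ω : (S.simulator E G).Sample => ω.1 0 := by fun_prop
  have hs := (S.measurePreserving_simulator_seed E G).measurable
  have hX : ∀ t, Measurable fun ω : (S.simulator E G).Sample =>
      (ω.2.2.1, S.simHist E G t ω, ω.1 0) := fun t =>
    hs.prodMk ((S.measurable_simHist E G t).prodMk hθ)
  have hY : ∀ t, Measurable fun ω : S.Sample => (ω.2.2, S.hist E t ω, ω.1 0) :=
    fun t => by fun_prop
  have : IsProbabilityMeasure (((S.simulator E G).prob E).map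
      (fun ω t => (ω.2.2.1, S.simHist E G t ω, ω.1 0))) :=
    Measure.isProbabilityMeasure_map (measurable_pi_lambda _ hX).aemeasurable
  have : IsProbabilityMeasure ((S.prob E).map (fun ω t => (ω.2.2, S.hist E t ω, ω.1 0))) :=
    Measure.isProbabilityMeasure_map (measurable_pi_lambda _ hY).aemeasurable
  -- A law on the product over all periods is determined by its finite-dimensional marginals.
  refine IsProjectiveLimit.unique (P := fun I => ((S.prob E).map
    (fun ω t => (ω.2.2, S.hist E t ω, ω.1 0))).map I.restrict) (fun I => ?_) (fun I => rfl)
  -- Histories of the periods in `I` are restrictions of the history at the latest one, so the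
  -- equality for a single period suffices.
  let n := I.sup id
  have hn : ∀ i : I, (i : ℕ) ≤ n := fun i => Finset.le_sup (f := id) i.2
  let R : S.Seed × Hist K n × ℝ → ∀ i : I, S.Seed × Hist K i × ℝ := fun q i =>
    (q.1, fun j => q.2.1 (j.castLE (Nat.succ_le_succ (hn i))), q.2.2)
  have hR : Measurable R := by
    refine measurable_pi_lambda _ fun i => ?_
    refine measurable_fst.prodMk (Measurable.prodMk (measurable_pi_lambda _ fun j => ?_) ?_)
    · exact (measurable_pi_apply _).comp (measurable_fst.comp measurable_snd)
    · exact measurable_snd.comp measurable_snd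
  beta_reduce
  rw [Measure.map_map (by fun_prop) (measurable_pi_lambda _ hX),
    Measure.map_map (by fun_prop) (measurable_pi_lambda _ hY)]
  have e1 : (I.restrict ∘ fun (ω : (S.simulator E G).Sample) t =>
      ((ω.2.2.1, S.simHist E G t ω, ω.1 0) : S.Seed × Hist K t × ℝ)) =
      R ∘ fun ω => (ω.2.2.1, S.simHist E G n ω, ω.1 0) := by
    funext ω i
    have h := Hist.eq_of_init (S.simHist E G) (S.init_simHist E G) (hn i) ω
    simp only [Function.comp, Finset.restrict, R]
    rw [h]
  have e2 : (I.restrict ∘ fun (ω : S.Sample) t =>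
      ((ω.2.2, S.hist E t ω, ω.1 0) : S.Seed × Hist K t × ℝ)) =
      R ∘ fun ω => (ω.2.2, S.hist E n ω, ω.1 0) := by
    funext ω i
    have h := Hist.eq_of_init (S.hist E) (S.init_hist E) (hn i) ω
    simp only [Function.comp, Finset.restrict, R]
    rw [h]
  rw [e1, e2, ← Measure.map_map hR (hX n), ← Measure.map_map hR (hY n),
    S.map_simHist_state E hG hf n]

variable (G) in
/-- The decision strategy that takes the actions prescribed by `A` at the simulated history. -/
noncomputable def simDecision {Act : ℕ → Type*} [∀ t, MeasurableSpace (Act t)]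
    (A : DecisionStrategy S Act) : DecisionStrategy (S.simulator E G) Act where
  act t p := A.act t (p.1.1, S.sim E G (t + 1) p)
  measurable_act t := (A.measurable_act t).comp
    ((measurable_fst.comp measurable_fst).prodMk (S.measurable_sim E G (t + 1)))

theorem expectedPayoff_simDecision (hG : IsConsistent G)
    (hf : ∀ (T : ℕ) (δ : DivSeq K T), S.Realized E δ →
      E.f (G T δ (Fin.last T)) ≤ E.f (δ (Fin.last T)))
    {Act : ℕ → Type*} [∀ t, MeasurableSpace (Act t)] {U : (∀ t, Act t) × ℝ → ℝ}
    (hU : Measurable U) (A : DecisionStrategy S Act) :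
    (S.simulator E G).expectedPayoff E (S.simDecision E G A) U = S.expectedPayoff E A U := by
  -- On the paths in question every coordinate carries the same state, so it may be read off at
  -- period 0.
  let V : (∀ t, S.Seed × Hist K t × ℝ) → ℝ := fun x =>
    U (fun t => A.act t ((x (t + 1)).1, (x (t + 1)).2.1), (x 0).2.2)
  have hV : Measurable V := by
    refine hU.comp (Measurable.prodMk (measurable_pi_lambda _ fun t => ?_) (by fun_prop))
    exact (A.measurable_act t).comp (by fun_prop)
  have hs := (S.measurePreserving_simulator_seed E G).measurable
  have hX : Measurable fun (ω : (S.simulator E G).Sample) (t : ℕ) =>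
      ((ω.2.2.1, S.simHist E G t ω, ω.1 0) : S.Seed × Hist K t × ℝ) :=
    measurable_pi_lambda _ fun t => hs.prodMk ((S.measurable_simHist E G t).prodMk (by fun_prop))
  have hY : Measurable fun (ω : S.Sample) (t : ℕ) =>
      ((ω.2.2, S.hist E t ω, ω.1 0) : S.Seed × Hist K t × ℝ) :=
    measurable_pi_lambda _ fun t => by fun_prop
  have key : ∀ F : ℝ → ℝ≥0∞, Measurable F →
      ∫⁻ ω, F ((S.simulator E G).payoff E (S.simDecision E G A) U ω)
        ∂((S.simulator E G).prob E) = ∫⁻ ω, F (S.payoff E A U ω) ∂(S.prob E) := by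
    intro F hF
    have h1 := lintegral_map (μ := (S.simulator E G).prob E) (hF.comp hV) hX
    have h2 := lintegral_map (μ := S.prob E) (hF.comp hV) hY
    rw [S.map_simHist_state_all E hG hf] at h1
    exact h1.symm.trans h2
  rw [expectedPayoff, expectedPayoff, key _ ENNReal.measurable_ofReal,
    key (fun x => ENNReal.ofReal (-x)) (by fun_prop)]

/-! ### Association of histories -/

variable (G) in
/-- The joint law of the simulated and the observed history. -/
noncomputable def jointLaw (T : ℕ) : Measure (Hist K T × Hist K T) :=
  ((S.simulator E G).prob E).map fun ω => (S.simHist E G T ω, (S.simulator E G).hist E T ω)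

theorem measurable_simHist_hist (T : ℕ) : Measurable fun ω : (S.simulator E G).Sample =>
    (S.simHist E G T ω, (S.simulator E G).hist E T ω) :=
  (S.measurable_simHist E G T).prodMk ((S.simulator E G).measurable_hist E T)

instance (T : ℕ) : IsProbabilityMeasure (S.jointLaw E G T) :=
  Measure.isProbabilityMeasure_map (S.measurable_simHist_hist E T).aemeasurable

theorem fst_jointLaw (hG : IsConsistent G)
    (hf : ∀ (T : ℕ) (δ : DivSeq K T), S.Realized E δ →
      E.f (G T δ (Fin.last T)) ≤ E.f (δ (Fin.last T))) (T : ℕ) :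
    (S.jointLaw E G T).fst = S.law E T := by
  have h := congrArg (Measure.map fun q : S.Seed × Hist K T × ℝ => q.2.1)
    (S.map_simHist_state E hG hf T)
  have hs := (S.measurePreserving_simulator_seed E G).measurable
  rw [Measure.map_map (by fun_prop) (hs.prodMk ((S.measurable_simHist E G T).prodMk
    (by fun_prop))), Measure.map_map (by fun_prop) (by fun_prop)] at h
  rw [Measure.fst, jointLaw, Measure.map_map measurable_fst (S.measurable_simHist_hist E T)]
  exact h

theorem snd_jointLaw (T : ℕ) : (S.jointLaw E G T).snd = (S.simulator E G).law E T := by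
  rw [Measure.snd, jointLaw, Measure.map_map measurable_snd (S.measurable_simHist_hist E T)]
  rfl

theorem map_init_jointLaw (T : ℕ) :
    (S.jointLaw E G (T + 1)).map (Prod.map Hist.init Hist.init) = S.jointLaw E G T := by
  rw [jointLaw, Measure.map_map (by fun_prop) (S.measurable_simHist_hist E _), jointLaw]
  congr 1
  funext ω
  simp only [Function.comp, Prod.map, init_simHist, init_hist]

variable (G) in
/-- The normal law of the posterior mean under the simulating strategy, given the history. -/
noncomputable def meanKernel (T : ℕ) : Kernel (Hist K T) ℝ where
  toFun h := gaussianReal (h (Fin.last T)).1 (E.varGap G (divs h)).toNNReal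
  measurable' := measurable_gaussianReal.comp
    ((by fun_prop : Measurable fun h : Hist K T => (h (Fin.last T)).1).prodMk (by fun_prop))

instance (T : ℕ) : IsMarkovKernel (meanKernel (K := K) E G T) :=
  ⟨fun h => by change IsProbabilityMeasure (gaussianReal _ _); infer_instance⟩

/-- This is the invariant `lintegral_simulator` with the seed forgotten. -/
theorem map_jointLaw_mean (hG : IsConsistent G)
    (hf : ∀ (T : ℕ) (δ : DivSeq K T), S.Realized E δ →
      E.f (G T δ (Fin.last T)) ≤ E.f (δ (Fin.last T))) (T : ℕ) :
    (S.jointLaw E G T).map (Prod.map id fun h' => (h' (Fin.last T)).1) =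
      (S.law E T) ⊗ₘ (meanKernel E G T) := by
  refine Measure.ext_of_lintegral _ fun φ hφ => ?_
  rw [jointLaw, Measure.map_map (by fun_prop) (S.measurable_simHist_hist E _),
    lintegral_map hφ (Measurable.comp (by fun_prop) (S.measurable_simHist_hist E _)),
    Measure.lintegral_compProd hφ, law,
    lintegral_map (Measurable.lintegral_kernel_prod_right' hφ) (S.measurable_hist E T)]
  refine (S.lintegral_simulator E hG hf T (φ := fun q => φ (q.2.1, q.2.2)) (by fun_prop)).trans
    (lintegral_congr fun ω => ?_)
  exact (lintegral_gaussianReal _ _ (φ := fun y => φ (S.hist E T ω, y)) (by fun_prop)).symm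

/-- Two disintegrations of the same law over the same marginal agree almost everywhere. -/
theorem condKernel_jointLaw_mean (hG : IsConsistent G)
    (hf : ∀ (T : ℕ) (δ : DivSeq K T), S.Realized E δ →
      E.f (G T δ (Fin.last T)) ≤ E.f (δ (Fin.last T))) (T : ℕ) :
    ∀ᵐ h ∂(S.law E T), ((S.jointLaw E G T).condKernel h).map (fun h' => (h' (Fin.last T)).1) =
      gaussianReal (h (Fin.last T)).1 (E.varGap G (divs h)).toNNReal := by
  have hm : Measurable fun h' : Hist K T => (h' (Fin.last T)).1 := by fun_prop
  have h1 : (S.law E T) ⊗ₘ ((S.jointLaw E G T).condKernel.map fun h' => (h' (Fin.last T)).1) =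
      (S.law E T) ⊗ₘ (meanKernel E G T) := by
    rw [Measure.compProd_map hm, ← S.fst_jointLaw E hG hf T, Measure.disintegrate,
      S.map_jointLaw_mean E hG hf T, S.fst_jointLaw E hG hf T]
  filter_upwards [Kernel.ae_eq_of_compProd_eq h1] with h hh
  rw [Kernel.map_apply _ hm] at hh
  exact hh

end InfoStrategy

end DynamicInfo

/-! ### The simulating strategy and the associating kernels -/

theorem lemma3 {K : ℕ} [NeZero K] (E : Environment K) (S : InfoStrategy K)
    (G : ∀ T : ℕ, DivSeq K T → DivSeq K T) (hG : IsConsistent G)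
    (hf : ∀ (T : ℕ) (δ : DivSeq K T), S.Realized E δ →
      E.f (G T δ (Fin.last T)) ≤ E.f (δ (Fin.last T))) :
    ∃ S' : InfoStrategy K,
      (∃ (κ : ∀ T : ℕ, Kernel (Hist K T) (Hist K T)) (η : ∀ T : ℕ, Kernel (Hist K T) (Hist K T)),
        -- `κ T h` is the distribution of histories associated with `h`; it has total mass one
        (∀ T, IsMarkovKernel (κ T)) ∧
        -- the associated histories have the remapped divisions
        (∀ T, ∀ᵐ h ∂(S.law E T), ∀ᵐ h' ∂(κ T h), divs h' = G T (divs h)) ∧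
        -- the associated histories occur under `S'` with the same probability as `h` under `S`
        (∀ T, (S.law E T).bind (κ T) = S'.law E T) ∧
        -- every history under `S'` is associated with total probability one
        (∀ T, IsMarkovKernel (η T)) ∧
        (∀ T, ((S.law E T).compProd (κ T)).map Prod.swap = (S'.law E T).compProd (η T)) ∧
        -- the posterior mean under `S'` is a normal mean-preserving spread of the one under `S`
        (∀ T, ∀ᵐ h ∂(S.law E T), (κ T h).map (fun h' => (h' (Fin.last T)).1) =
          gaussianReal (h (Fin.last T)).1 (Real.toNNReal
            (E.f (divs h (Fin.last T)) - E.f (G T (divs h) (Fin.last T))))) ∧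
        -- the associations at successive periods extend one another
        (∀ T, ((S.law E (T + 1)).compProd (κ (T + 1))).map (Prod.map Hist.init Hist.init) =
          (S.law E T).compProd (κ T))) ∧
      -- in every decision problem, `S'` does at least as well as `S`
      (∀ (Act : ℕ → Type*) [∀ t, MeasurableSpace (Act t)] (U : (∀ t, Act t) × ℝ → ℝ),
        Measurable U → ∀ A : DecisionStrategy S Act, ∃ A' : DecisionStrategy S' Act,
          S.expectedPayoff E A U ≤ S'.expectedPayoff E A' U) := by
  have hdis : ∀ T, (S.law E T) ⊗ₘ (S.jointLaw E G T).condKernel = S.jointLaw E G T := fun T => by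
    rw [← S.fst_jointLaw E hG hf T, Measure.disintegrate]
  -- Both kernels disintegrate one joint law, in the two directions; `hdis` reduces each claim about
  -- the association to this law. Payoffs under the two strategies are in fact equal.
  refine ⟨S.simulator E G, ⟨fun T => (S.jointLaw E G T).condKernel,
    fun T => ((S.jointLaw E G T).map Prod.swap).condKernel, fun T => inferInstance, fun T => ?_,
    fun T => ?_, fun T => ?_, fun T => ?_, S.condKernel_jointLaw_mean E hG hf, fun T => ?_⟩,
    fun Act _ U hU A => ⟨S.simDecision E G A, (S.expectedPayoff_simDecision E hG hf hU A).ge⟩⟩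
  · refine Measure.ae_ae_of_ae_compProd (p := fun q => divs q.2 = G T (divs q.1)) ?_
    rw [hdis, InfoStrategy.jointLaw, ae_map_iff (S.measurable_simHist_hist E T).aemeasurable]
    · exact ae_of_all _ fun ω => S.divs_hist_simulator E hG T ω
    · refine measurableSet_eq_fun (by fun_prop) ?_
      exact (measurable_of_countable (G T)).comp (by fun_prop)
  · rw [← S.snd_jointLaw E T, ← hdis, Measure.snd_compProd]
  · have : IsProbabilityMeasure ((S.jointLaw E G T).map Prod.swap) :=
      Measure.isProbabilityMeasure_map measurable_swap.aemeasurable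
    infer_instance
  · have : IsProbabilityMeasure ((S.jointLaw E G T).map Prod.swap) :=
      Measure.isProbabilityMeasure_map measurable_swap.aemeasurable
    rw [hdis, ← S.snd_jointLaw E T, ← Measure.fst_map_swap, Measure.disintegrate]
  · rw [hdis, hdis, S.map_init_jointLaw]
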